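/- Let $K\subset S^3$ be an oriented (smooth) knot, $\pi=\pi_1(S^3\setminus K)$, and let $m,l\in\pi$ be the homotopy classes of the meridian and of the zero-framed (null-homologous in $S^3\setminus K$) longitude, taken on the boundary torus of a tubular neighbourhood of $K$. The cord algebra of $K$ is the quotient of the tensor algebra over $\mathbb{Z}[\lambda^{\pm1},\mu^{\pm1}]$ freely generated by the set of symbols $[\gamma]$, $\gamma\in\pi$, by the relations $[e]=1+\mu$; $[\gamma m]=[m\gamma]=\mu[\gamma]$ and $[\gamma l]=[l\gamma]=\lambda[\gamma]$ for $\gamma\in\pi$; and $[\gamma_1\gamma_2]+[\gamma_1m\gamma_2]=[\gamma_1][\gamma_2]$ for $\gamma_1,\gamma_2\in\pi$. Let $E_K\subset(\mathbb{C}^*)^2$ be the set of pairs $(\lambda,\mu)$ for which there is a homomorphism $\rho:\pi\to SL_2(\mathbb{C})$ with $\rho(l)=\begin{pmatrix}\lambda&*\\0&\lambda^{-1}\end{pmatrix}$ and $\rho(m)=\begin{pmatrix}\mu&*\\0&\mu^{-1}\end{pmatrix}$. The A-polynomial $A_K(\lambda,\mu)\in\mathbb{C}[\lambda,\mu]$ is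 the polynomial without repeated factors and not divisible by $\lambda$ or $\mu$ (unique up to a nonzero constant) whose zero set in $(\mathbb{C}^*)^2$ is the union of the one-dimensional irreducible components of the Zariski closure of $E_K$. Let $V_K\subset(\mathbb{C}^*)^2$ be the set of pairs $(\lambda_0,\mu_0)$ for which there is a ring homomorphism from the cord algebra to $\mathbb{C}$ sending $\lambda\mapsto\lambda_0$ and $\mu\mapsto\mu_0$. Assume that the Zariski closure of $V_K$ is one-dimensional, and let $\widetilde A_K(\lambda,\mu)\in\mathbb{C}[\lambda,\mu]$ be an augmentation polynomial of $K$, that is, any polynomial whose zero set in $(\mathbb{C}^*)^2$ is the union of the one-dimensional irreducible components of the Zariski closure of $V_K$ (for instance the one without repeated factors). Then $(1-\mu^2)A_K(\lambda,\mu)$ divides $\widetilde A_K(\lambda,-\mu^2)$ in $\mathbb{C}[\lambda,\mu]$. -/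

import Mathlib

open scoped Manifold ContDiff

/-! ### Knots in the three-sphere, their groups and peripheral elements -/

/-- The unit sphere in `ℝ⁴`. -/
abbrev S3 : Type := Metric.sphere (0 : EuclideanSpace ℝ (Fin 4)) 1

/-- An oriented knot in `S³`: a smooth embedding of the circle. The orientation is the one
given by the parametrisation. -/
structure OrientedKnot where
  toFun : Circle → S3
  smoothEmbedding : Manifold.IsSmoothEmbedding (𝓡 1) (𝓡 3) ∞ toFun

namespace OrientedKnot

/-- The knot as a subset of `S³`. -/
def carrier (K : OrientedKnot) : Set S3 := Set.range K.toFun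

/-- The knot complement `S³ \ K`. -/
abbrev Complement (K : OrientedKnot) : Type := {x : S3 // x ∉ K.carrier}

/-- A framed tubular neighbourhood of `K`: an orientation-preserving smooth open embedding of
`S¹ × ℂ` into `S³` that restricts to `K` on `S¹ × {0}`. Here `S³` is oriented as the boundary of
the unit ball of `ℝ⁴`, so a basis `v₁, v₂, v₃` of the tangent space at `x` is positive when
`det (x, v₁, v₂, v₃) > 0`. -/
structure TubularNeighborhood (K : OrientedKnot) where
  toFun : Circle × ℂ → S3
  smooth : ContMDiff ((𝓡 1).prod 𝓘(ℝ, ℂ)) (𝓡 3) ∞ toFun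
  isOpenEmbedding : Topology.IsOpenEmbedding toFun
  core : ∀ θ : Circle, toFun (θ, 0) = K.toFun θ
  orientation : ∀ (θ : Circle) (z : ℂ),
    0 < Matrix.det (Matrix.of fun i j : Fin 4 =>
      (![(toFun (θ, z) : EuclideanSpace ℝ (Fin 4)),
         deriv (fun t : ℝ =>
           (toFun (θ * Circle.exp t, z) : EuclideanSpace ℝ (Fin 4))) 0,
         deriv (fun t : ℝ => (toFun (θ, z + t) : EuclideanSpace ℝ (Fin 4))) 0,
         deriv (fun t : ℝ =>
           (toFun (θ, z + t * Complex.I) : EuclideanSpace ℝ (Fin 4))) 0] i) j)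

namespace TubularNeighborhood

variable {K : OrientedKnot}

theorem notMem_carrier (N : K.TubularNeighborhood) (θ : Circle) {z : ℂ} (hz : z ≠ 0) :
    N.toFun (θ, z) ∉ K.carrier := by
  rintro ⟨η, hη⟩
  rw [← N.core η] at hη
  exact hz (congrArg Prod.snd (N.isOpenEmbedding.injective hη)).symm

/-- The torus `S¹ × S¹` inside the neighbourhood, as a map to the knot complement. -/
noncomputable def torus (N : K.TubularNeighborhood) (p : Circle × Circle) : K.Complement :=
  ⟨N.toFun (p.1, (p.2 : ℂ)), N.notMem_carrier p.1 (Circle.coe_ne_zero p.2)⟩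

theorem continuous_torus (N : K.TubularNeighborhood) : Continuous N.torus := by
  refine Continuous.subtype_mk (N.isOpenEmbedding.continuous.comp ?_) _
  fun_prop

/-- The base point of the knot complement: a point of the torus. -/
noncomputable def basePoint (N : K.TubularNeighborhood) : K.Complement := N.torus (1, 1)

/-- The knot group `π₁(S³ \ K)`. Mathlib multiplies loops in the order opposite to
concatenation; after passing to the opposite group `γ₁ * γ₂` is "first `γ₁`, then `γ₂`". -/
abbrev KnotGroup (N : K.TubularNeighborhood) : Type :=
  (FundamentalGroup K.Complement N.basePoint)ᵐᵒᵖ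

/-- The loop `s ↦ (1, exp(2πis))` on the torus. -/
noncomputable def meridianLoop (N : K.TubularNeighborhood) : Path N.basePoint N.basePoint where
  toFun s := N.torus (1, Circle.exp (2 * Real.pi * s))
  continuous_toFun := N.continuous_torus.comp (by fun_prop)
  source' := by simp [basePoint]
  target' := by simp [basePoint]

/-- The loop `s ↦ (exp(2πis), 1)` on the torus. -/
noncomputable def longitudeLoop (N : K.TubularNeighborhood) : Path N.basePoint N.basePoint where
  toFun s := N.torus (Circle.exp (2 * Real.pi * s), 1)
  continuous_toFun := N.continuous_torus.comp (by fun_prop)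
  source' := by simp [basePoint]
  target' := by simp [basePoint]

/-- The homotopy class `m` of the meridian. -/
noncomputable def meridian (N : K.TubularNeighborhood) : N.KnotGroup :=
  MulOpposite.op (FundamentalGroup.fromPath (Path.Homotopic.Quotient.mk N.meridianLoop))

/-- The homotopy class `l` of the longitude given by the framing `N`. -/
noncomputable def longitude (N : K.TubularNeighborhood) : N.KnotGroup :=
  MulOpposite.op (FundamentalGroup.fromPath (Path.Homotopic.Quotient.mk N.longitudeLoop))

/-- `N` gives the zero framing (the Seifert framing): its longitude is null-homologous in the knot
complement, that is, it vanishes in the abelianised knot group. -/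
def IsZeroFraming (N : K.TubularNeighborhood) : Prop :=
  N.longitude ∈ commutator N.KnotGroup

end TubularNeighborhood

end OrientedKnot

/-! ### The cord algebra -/

/-- The ring `ℤ[λ^{±1}, μ^{±1}]`, as the group ring of `ℤ²`. -/
abbrev LaurentZ2 : Type := AddMonoidAlgebra ℤ (ℤ × ℤ)

/-- The variable `λ`. -/
noncomputable def lam : LaurentZ2 := AddMonoidAlgebra.single (1, 0) 1

/-- The variable `μ`. -/
noncomputable def mu : LaurentZ2 := AddMonoidAlgebra.single (0, 1) 1

/-- The defining relations of the cord algebra on the free (tensor) algebra generated by the set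
underlying the group `Γ` with meridian `m` and longitude `l`. The generator `[γ]` is
`FreeAlgebra.ι LaurentZ2 γ`. -/
inductive CordRel {Γ : Type} [Group Γ] (m l : Γ) :
    FreeAlgebra LaurentZ2 Γ → FreeAlgebra LaurentZ2 Γ → Prop
  | one : CordRel m l (FreeAlgebra.ι LaurentZ2 1)
      (algebraMap LaurentZ2 (FreeAlgebra LaurentZ2 Γ) (1 + mu))
  | mul_meridian (γ : Γ) : CordRel m l (FreeAlgebra.ι LaurentZ2 (γ * m))
      (mu • FreeAlgebra.ι LaurentZ2 γ)
  | meridian_mul (γ : Γ) : CordRel m l (FreeAlgebra.ι LaurentZ2 (m * γ))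
      (mu • FreeAlgebra.ι LaurentZ2 γ)
  | mul_longitude (γ : Γ) : CordRel m l (FreeAlgebra.ι LaurentZ2 (γ * l))
      (lam • FreeAlgebra.ι LaurentZ2 γ)
  | longitude_mul (γ : Γ) : CordRel m l (FreeAlgebra.ι LaurentZ2 (l * γ))
      (lam • FreeAlgebra.ι LaurentZ2 γ)
  | skein (γ₁ γ₂ : Γ) : CordRel m l
      (FreeAlgebra.ι LaurentZ2 (γ₁ * γ₂) + FreeAlgebra.ι LaurentZ2 (γ₁ * m * γ₂))
      (FreeAlgebra.ι LaurentZ2 γ₁ * FreeAlgebra.ι LaurentZ2 γ₂)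

/-- The cord algebra. -/
abbrev CordAlgebra {Γ : Type} [Group Γ] (m l : Γ) : Type := RingQuot (CordRel m l)

/-! ### The two plane curves

Points of `ℂ²` are functions `x : Fin 2 → ℂ`, with `x 0` the `λ`-coordinate and `x 1` the
`μ`-coordinate; polynomials in `λ, μ` are elements of `MvPolynomial (Fin 2) ℂ`. -/

/-- The pairs `(λ, μ)` in `(ℂ*)²` for which the cord algebra has a ring map to `ℂ` with the two
variables going to `λ` and `μ`. -/
def augmentationSet {Γ : Type} [Group Γ] (m l : Γ) : Set (Fin 2 → ℂ) :=
  {x | x 0 ≠ 0 ∧ x 1 ≠ 0 ∧ ∃ φ : CordAlgebra m l →+* ℂ,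
    φ (algebraMap LaurentZ2 (CordAlgebra m l) lam) = x 0 ∧
    φ (algebraMap LaurentZ2 (CordAlgebra m l) mu) = x 1}

/-- The pairs of eigenvalues `(λ, μ)` over all `SL₂(ℂ)`-representations for which `l` and `m` go
to upper triangular matrices. The determinant condition forces `λ` and `μ` to be nonzero. -/
def eigenvalueSet {Γ : Type} [Group Γ] (m l : Γ) : Set (Fin 2 → ℂ) :=
  {x | ∃ (ρ : Γ →* Matrix.SpecialLinearGroup (Fin 2) ℂ) (s t : ℂ),
    (ρ l : Matrix (Fin 2) (Fin 2) ℂ) = !![x 0, s; 0, (x 0)⁻¹] ∧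
    (ρ m : Matrix (Fin 2) (Fin 2) ℂ) = !![x 1, t; 0, (x 1)⁻¹]}

/-- The coordinate ring of the Zariski closure of `S`. -/
abbrev ClosureCoordinateRing (S : Set (Fin 2 → ℂ)) : Type :=
  MvPolynomial (Fin 2) ℂ ⧸ MvPolynomial.vanishingIdeal ℂ S

/-- The zero set of `P` in `(ℂ*)²` is the union of the one-dimensional irreducible components of
the Zariski closure of `S`. Irreducible components are given by the minimal primes over the
vanishing ideal. -/
def CutsOutCurves (P : MvPolynomial (Fin 2) ℂ) (S : Set (Fin 2 → ℂ)) : Prop :=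
  ∀ x : Fin 2 → ℂ, x 0 ≠ 0 → x 1 ≠ 0 →
    (MvPolynomial.eval x P = 0 ↔
      ∃ p ∈ (MvPolynomial.vanishingIdeal ℂ S).minimalPrimes,
        ringKrullDim (MvPolynomial (Fin 2) ℂ ⧸ p) = 1 ∧ x ∈ MvPolynomial.zeroLocus ℂ p)

namespace OrientedKnot.TubularNeighborhood

variable {K : OrientedKnot}

/-- `A` is the A-polynomial of `K`: the polynomial without repeated factors and without factors
`λ`, `μ` (so it is unique up to a nonzero constant) whose zero set in `(ℂ*)²` is the union of the
one-dimensional components of the eigenvalue variety. -/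
structure IsAPolynomial (N : K.TubularNeighborhood) (A : MvPolynomial (Fin 2) ℂ) : Prop where
  cutsOut : CutsOutCurves A (eigenvalueSet N.meridian N.longitude)
  squarefree : Squarefree A
  not_dvd : ∀ i : Fin 2, ¬ MvPolynomial.X i ∣ A

/-- The augmentation variety of `K` (the Zariski closure of the set of all `(λ, μ)` that admit an
augmentation) is one-dimensional. -/
def AugmentationVarietyIsCurve (N : K.TubularNeighborhood) : Prop :=
  ringKrullDim (ClosureCoordinateRing (augmentationSet N.meridian N.longitude)) = 1

/-- `P` is an augmentation polynomial of `K`: its zero set in `(ℂ*)²` is the (one-dimensional part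
of the) augmentation variety. Repeated factors and monomial factors are allowed. -/
def IsAugmentationPolynomial (N : K.TubularNeighborhood) (P : MvPolynomial (Fin 2) ℂ) : Prop :=
  CutsOutCurves P (augmentationSet N.meridian N.longitude)

end OrientedKnot.TubularNeighborhood

/-! Let ρ be an `SL₂`-representation with eigenvalues (λ, μ), where μ² ≠ 1. The matrices ρ(m) and
ρ(l) share the right eigenvector e = (1, 0). As m and l commute, they also share a left eigenvector
ω with ω(e) = 1. Choose a character χ of the knot group with χ(m) = -μ; then χ(l) = 1, since l is a
product of commutators. Setting [γ] ↦ (1 - μ²) χ(γ) ω(ρ(γ)e) gives an augmentation over (λ, -μ²).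
The skein relation holds because 1 - μρ(m) is the rank one matrix (1 - μ²) e ω. Over μ = -1, sending
every [γ] to 0 is an augmentation. This yields the factor 1 - μ² after the substitution μ ↦ -μ².

To pass from points to polynomials, note that the substitution is a finite map of the plane. The
image of each irreducible curve f = 0 in (1 - μ²)A = 0 is therefore a curve inside the augmentation
variety. Since that variety is one-dimensional, f divides the substituted augmentation polynomial
(`dvd_negSqSubst`). The product (1 - μ²)A is squarefree because μ² = 1 forces λ² = 1 on the
eigenvalue set (`sq_eq_one_of_mem_eigenvalueSet`), so neither line μ = ±1 is a component.

The topological inputs are that m and l commute (`meridian_mul_longitude`), that m normally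
generates l (`longitude_mem_normalClosure`), and that characters take any value on m
(`exists_character`). The second holds because killing m leaves the trivial fundamental group of the
sphere, shown by a van Kampen argument with holonomies. The third uses a line bundle on the sphere
with a section vanishing to first order along the knot. The bundle is trivial, so the section
becomes a function that winds once around each meridian. -/

/-! ### Augmentations from representations of a group with peripheral elements. -/

theorem mem_augmentationSet_of_function {Γ : Type} [Group Γ] {m l : Γ} {x : Fin 2 → ℂ}
    (h0 : x 0 ≠ 0) (h1 : x 1 ≠ 0) (f : Γ → ℂ) (f_one : f 1 = 1 + x 1)
    (f_mul_m : ∀ γ, f (γ * m) = x 1 * f γ) (f_m_mul : ∀ γ, f (m * γ) = x 1 * f γ)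
    (f_mul_l : ∀ γ, f (γ * l) = x 0 * f γ) (f_l_mul : ∀ γ, f (l * γ) = x 0 * f γ)
    (f_skein : ∀ γ₁ γ₂, f (γ₁ * γ₂) + f (γ₁ * m * γ₂) = f γ₁ * f γ₂) :
    x ∈ augmentationSet m l := by
  let u : Fin 2 → ℂˣ := ![Units.mk0 _ h0, Units.mk0 _ h1]
  let e : Multiplicative (ℤ × ℤ) →* ℂ :=
    { toFun := fun k => ((u 0 ^ k.toAdd.1 * u 1 ^ k.toAdd.2 : ℂˣ) : ℂ)
      map_one' := by simp
      map_mul' := fun a b => by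
        rw [← Units.val_mul, toAdd_mul, Prod.fst_add, Prod.snd_add, zpow_add, zpow_add,
          mul_mul_mul_comm] }
  let ev : LaurentZ2 →+* ℂ := (AddMonoidAlgebra.lift ℤ ℂ (ℤ × ℤ) e).toRingHom
  have ev_lam : ev lam = x 0 := by
    simp [ev, lam, e, u]
  have ev_mu : ev mu = x 1 := by
    simp [ev, mu, e, u]
  -- With ℂ an algebra over the Laurent ring via evaluation at (λ, μ), the universal properties of
  -- the free algebra and its quotient apply directly.
  let _ : Algebra LaurentZ2 ℂ := ev.toAlgebra
  have hsm : ∀ (a : LaurentZ2) (z : ℂ), a • z = ev a * z := fun a z => Algebra.smul_def a z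
  have ham : ∀ a : LaurentZ2, algebraMap LaurentZ2 ℂ a = ev a := fun a => rfl
  have hrel : ∀ ⦃a b : FreeAlgebra LaurentZ2 Γ⦄, CordRel m l a b →
      FreeAlgebra.lift LaurentZ2 f a = FreeAlgebra.lift LaurentZ2 f b := by
    intro a b hab
    cases hab <;>
      simp [hsm, ham, ev_lam, ev_mu, f_one, f_mul_m, f_m_mul, f_mul_l, f_l_mul, f_skein]
  let φ := RingQuot.liftAlgHom LaurentZ2 ⟨FreeAlgebra.lift LaurentZ2 f, hrel⟩
  refine ⟨h0, h1, φ.toRingHom, ?_, ?_⟩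
  · exact (φ.commutes lam).trans ev_lam
  · exact (φ.commutes mu).trans ev_mu

/-- When 1 + μ = 0, every relation is compatible with sending all generators to zero. -/
theorem mem_augmentationSet_of_neg_one {Γ : Type} [Group Γ] (m l : Γ) {x : Fin 2 → ℂ}
    (h0 : x 0 ≠ 0) (h1 : x 1 = -1) : x ∈ augmentationSet m l := by
  refine mem_augmentationSet_of_function h0 (by simp [h1]) (fun _ => 0) ?_ ?_ ?_ ?_ ?_ ?_ <;>
    simp [h1]

/-- This is the upper right entry of the commutation relation. It says that the two matrices share
their second eigendirection. -/
theorem upperTriangular_comm {a b s t : ℂ} (ha : a ≠ 0) (hb : b ≠ 0)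
    (h : !![a, s; 0, a⁻¹] * !![b, t; 0, b⁻¹] = !![b, t; 0, b⁻¹] * !![a, s; 0, a⁻¹]) :
    s * a * (b ^ 2 - 1) = t * b * (a ^ 2 - 1) := by
  have h01 := congrFun (congrFun h 0) 1
  simp [Matrix.mul_apply, Fin.sum_univ_two] at h01
  field_simp at h01
  linear_combination -h01

theorem eigenvalueSet_ne_zero {Γ : Type} [Group Γ] {m l : Γ} {x : Fin 2 → ℂ}
    (hx : x ∈ eigenvalueSet m l) : x 0 ≠ 0 ∧ x 1 ≠ 0 := by
  obtain ⟨ρ, s, t, hl, hm⟩ := hx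
  have h1 := (ρ l).2
  have h2 := (ρ m).2
  rw [hl, Matrix.det_fin_two_of] at h1
  rw [hm, Matrix.det_fin_two_of] at h2
  constructor
  · intro h; simp [h] at h1
  · intro h; simp [h] at h2

/-- Twisting an `SL₂`-representation by a character gives an augmentation. -/
theorem mem_augmentationSet_of_mem_eigenvalueSet {Γ : Type} [Group Γ] {m l : Γ}
    (hcomm : m * l = l * m) {x : Fin 2 → ℂ} (hx : x ∈ eigenvalueSet m l) (hx1 : x 1 ^ 2 ≠ 1)
    (χ : Γ →* ℂˣ) (hχm : (χ m : ℂ) = -x 1) (hχl : χ l = 1) :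
    ![x 0, -(x 1 ^ 2)] ∈ augmentationSet m l := by
  obtain ⟨h0, h1⟩ := eigenvalueSet_ne_zero hx
  obtain ⟨ρ, s, t, hl, hm⟩ := hx
  have hc : s * x 0 * (x 1 ^ 2 - 1) = t * x 1 * (x 0 ^ 2 - 1) := by
    apply upperTriangular_comm h0 h1
    rw [← hl, ← hm, ← Matrix.SpecialLinearGroup.coe_mul, ← Matrix.SpecialLinearGroup.coe_mul,
      ← map_mul, ← map_mul, hcomm]
  have hd : 1 - x 1 ^ 2 ≠ 0 := sub_ne_zero.2 hx1.symm
  -- The row vector (1, -v) is the left eigenvector of ρ(m) for the eigenvalue `x 1`; by `hc` it is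
  -- also one of ρ(l) for `x 0`.
  set v : ℂ := x 1 * t / (1 - x 1 ^ 2) with hv
  have hvt : t * x 1 = v * (1 - x 1 ^ 2) := by rw [hv]; field_simp
  have hvs : s * x 0 = v * (1 - x 0 ^ 2) := by
    apply mul_right_cancel₀ hd
    linear_combination -hc + (1 - x 0 ^ 2) * hvt
  have hs : s = v * (1 - x 0 ^ 2) / x 0 := by rw [← hvs]; field_simp
  have ht : t = v * (1 - x 1 ^ 2) / x 1 := by rw [← hvt]; field_simp
  -- The last factor is (1, -v) ρ(γ) (1, 0)ᵀ. The normalisation 1 - μ² is the nonzero eigenvalue of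
  -- the rank one matrix 1 - μρ(m) in the skein relation.
  refine mem_augmentationSet_of_function (by simpa using h0) (by simpa using h1)
    (fun γ => (1 - x 1 ^ 2) * (χ γ : ℂ) *
      ((ρ γ : Matrix (Fin 2) (Fin 2) ℂ) 0 0 - v * (ρ γ : Matrix (Fin 2) (Fin 2) ℂ) 1 0))
    ?_ ?_ ?_ ?_ ?_ ?_
  · simp; ring
  · intro γ
    simp [hm, Matrix.mul_apply, Fin.sum_univ_two, hχm]; ring
  · intro γ
    simp [hm, Matrix.mul_apply, Fin.sum_univ_two, hχm, ht]; field_simp; ring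
  · intro γ
    simp [hl, Matrix.mul_apply, Fin.sum_univ_two, hχl]; ring
  · intro γ
    simp [hl, Matrix.mul_apply, Fin.sum_univ_two, hχl, hs]; field_simp; ring
  · intro γ₁ γ₂
    simp [hm, Matrix.mul_apply, Fin.sum_univ_two, hχm, ht]; field_simp; ring

/-- If ρ(m) = ±1 it is central, hence so is ρ(l), which lies in the normal closure of ρ(m).
Otherwise ρ(m) is ± a nontrivial unipotent, and whatever commutes with it has equal eigenvalues. -/
theorem sq_eq_one_of_mem_eigenvalueSet {Γ : Type} [Group Γ] {m l : Γ}
    (hcomm : m * l = l * m) (hl : l ∈ Subgroup.normalClosure {m}) {x : Fin 2 → ℂ}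
    (hx : x ∈ eigenvalueSet m l) (hx1 : x 1 ^ 2 = 1) : x 0 ^ 2 = 1 := by
  obtain ⟨h0, h1⟩ := eigenvalueSet_ne_zero hx
  obtain ⟨ρ, s, t, hρl, hρm⟩ := hx
  have hc : s * x 0 * (x 1 ^ 2 - 1) = t * x 1 * (x 0 ^ 2 - 1) := by
    apply upperTriangular_comm h0 h1
    rw [← hρl, ← hρm, ← Matrix.SpecialLinearGroup.coe_mul, ← Matrix.SpecialLinearGroup.coe_mul,
      ← map_mul, ← map_mul, hcomm]
  by_cases ht : t = 0
  · have hinv : (x 1)⁻¹ = x 1 := by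
      exact inv_eq_of_mul_eq_one_right (by rw [← sq, hx1])
    have hmc : ρ m ∈ Subgroup.center (Matrix.SpecialLinearGroup (Fin 2) ℂ) := by
      rw [Matrix.SpecialLinearGroup.mem_center_iff]
      refine ⟨x 1, by simpa using hx1, ?_⟩
      rw [hρm, ht, hinv]
      ext i j; fin_cases i <;> fin_cases j <;> simp
    have hlc : ρ l ∈ Subgroup.center (Matrix.SpecialLinearGroup (Fin 2) ℂ) := by
      have : Subgroup.normalClosure {m} ≤
          (Subgroup.center (Matrix.SpecialLinearGroup (Fin 2) ℂ)).comap ρ :=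
        Subgroup.normalClosure_le_normal (by simpa using hmc)
      exact this hl
    obtain ⟨r, hr, hrl⟩ := Matrix.SpecialLinearGroup.mem_center_iff.1 hlc
    rw [hρl] at hrl
    have h00 := congrFun (congrFun hrl 0) 0
    simp at h00
    simpa [h00] using hr
  · rw [hx1, sub_self, mul_zero, eq_comm] at hc
    exact sub_eq_zero.1 ((mul_eq_zero.1 hc).resolve_left (mul_ne_zero ht h1))

/-! ### Components of plane curves and divisibility. -/

namespace MvPolynomial

theorem mem_of_forall_mem_zeroLocus {σ k : Type*} [Field k] [IsAlgClosed k] [Finite σ]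
    {P : Ideal (MvPolynomial σ k)} [P.IsPrime] {h : MvPolynomial σ k}
    (hh : ∀ x ∈ zeroLocus k P, eval x h = 0) : h ∈ P := by
  rw [← IsPrime.vanishingIdeal_zeroLocus (K := k) P]
  intro x hx
  simpa [aeval_eq_eval] using hh x hx

/-- A minimal prime over the vanishing ideal of `S` is the vanishing ideal of the points of `S`
on it, even after removing the zeros of a polynomial outside of the prime. -/
theorem mem_minimalPrime_vanishingIdeal {σ k : Type*} [Field k] [Finite σ]
    {S : Set (σ → k)} {p : Ideal (MvPolynomial σ k)}
    (hp : p ∈ (vanishingIdeal k S).minimalPrimes) {g h : MvPolynomial σ k} (hg : g ∉ p)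
    (hh : ∀ x ∈ S, (∀ f ∈ p, eval x f = 0) → eval x g ≠ 0 → eval x h = 0) : h ∈ p := by
  have hpp : p.IsPrime := hp.1.1
  have hfin := (vanishingIdeal k S).finite_minimalPrimes_of_isNoetherianRing
  have hex : ∀ q ∈ (vanishingIdeal k S).minimalPrimes, q ≠ p → ∃ e ∈ q, e ∉ p := by
    intro q hq hqp
    by_contra! hle
    exact hqp (le_antisymm hle (hp.2 hq.1 hle))
  choose! e he hep using hex
  -- The polynomial d vanishes on all other components but not identically on the component of p.
  let d := ∏ q ∈ hfin.toFinset.erase p, e q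
  have hd : d ∉ p := by
    rw [hpp.prod_mem_iff]
    rintro ⟨q, hq, hqe⟩
    rw [Finset.mem_erase, Set.Finite.mem_toFinset] at hq
    exact hep q hq.2 hq.1 hqe
  have hmem : h * (g * d) ∈ vanishingIdeal k S := by
    intro x hx
    obtain ⟨q, hq, hqx⟩ := Ideal.exists_minimalPrimes_le
      (vanishingIdeal_anti_mono (k := k) (Set.singleton_subset_iff.2 hx))
    have hqx' : ∀ f ∈ q, eval x f = 0 := fun f hf => by
      simpa [aeval_eq_eval] using hqx hf x rfl
    rw [aeval_eq_eval]
    change eval x (h * (g * d)) = 0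
    rw [map_mul, map_mul]
    by_cases hqp : q = p
    · subst hqp
      by_cases hgx : eval x g = 0
      · rw [hgx, zero_mul, mul_zero]
      · rw [hh x hx hqx' hgx, zero_mul]
    · have : eval x d = 0 := hqx' _ <| Ideal.mem_of_dvd _
        (Finset.dvd_prod_of_mem e (by simp [hqp, hq])) (he q hq hqp)
      rw [this, mul_zero, mul_zero]
  rcases hpp.mem_or_mem (hp.1.2 hmem) with h1 | h1
  · exact h1
  · exact absurd h1 (hpp.mul_notMem hg hd)

/-- A nonzero prime of a factorial ring contains a prime element. Here that element is a multiple of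
f, hence associated to it. -/
theorem minimalPrime_eq_span_of_le {p : Ideal (MvPolynomial (Fin 2) ℂ)} [hp : p.IsPrime]
    (hdim : ringKrullDim (MvPolynomial (Fin 2) ℂ ⧸ p) = 1) {f : MvPolynomial (Fin 2) ℂ}
    (hf : Irreducible f) (hle : p ≤ Ideal.span {f}) : p = Ideal.span {f} := by
  have hbot : p ≠ ⊥ := by
    rintro rfl
    rw [ringKrullDim_eq_of_ringEquiv (RingEquiv.quotientBot _),
      MvPolynomial.ringKrullDim_of_isNoetherianRing, ringKrullDim_eq_zero_of_field] at hdim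
    simp at hdim
  obtain ⟨g, hgp, hg⟩ := hp.exists_mem_prime_of_ne_bot hbot
  refine le_antisymm hle ?_
  rw [Ideal.span_singleton_le_iff_mem]
  have hfg : f ∣ g := Ideal.mem_span_singleton.1 (hle hgp)
  exact Ideal.mem_of_dvd _ ((hf.dvd_symm hg.irreducible) hfg) hgp

/-- If the curve f = 0 were not a component, each one-dimensional component would carry a polynomial
outside (f). Their product vanishes on f = 0 off the axes, and the Nullstellensatz puts it in (f).
-/
theorem span_mem_minimalPrimes {A f : MvPolynomial (Fin 2) ℂ} {S : Set (Fin 2 → ℂ)}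
    (hA : CutsOutCurves A S) (hf : Irreducible f) (hfA : f ∣ A)
    (hX : ∀ i, (X i : MvPolynomial (Fin 2) ℂ) ∉ Ideal.span {f}) :
    Ideal.span {f} ∈ (vanishingIdeal ℂ S).minimalPrimes := by
  have hprime : (Ideal.span {f}).IsPrime := (Ideal.span_singleton_prime hf.ne_zero).2 hf.prime
  have hfin := (vanishingIdeal ℂ S).finite_minimalPrimes_of_isNoetherianRing
  by_contra hnot
  have hex : ∀ q ∈ (vanishingIdeal ℂ S).minimalPrimes,
      ringKrullDim (MvPolynomial (Fin 2) ℂ ⧸ q) = 1 → ∃ e ∈ q, e ∉ Ideal.span {f} := by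
    intro q hq hqd
    by_contra! hle
    have := hq.1.1
    exact hnot (minimalPrime_eq_span_of_le hqd hf hle ▸ hq)
  choose! e he hef using hex
  classical
  let d := ∏ q ∈ hfin.toFinset with ringKrullDim (MvPolynomial (Fin 2) ℂ ⧸ q) = 1, e q
  have hd : d ∉ Ideal.span {f} := by
    rw [hprime.prod_mem_iff]
    rintro ⟨q, hq, hqe⟩
    rw [Finset.mem_filter, Set.Finite.mem_toFinset] at hq
    exact hef q hq.1 hq.2 hqe
  have hmem : X 0 * (X 1 * d) ∈ Ideal.span {f} := by
    apply mem_of_forall_mem_zeroLocus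
    intro x hx
    rw [map_mul, map_mul, eval_X, eval_X]
    by_cases h0 : x 0 = 0
    · simp [h0]
    by_cases h1 : x 1 = 0
    · simp [h1]
    have hxA : eval x A = 0 := by
      simpa [aeval_eq_eval] using hx A (Ideal.mem_span_singleton.2 hfA)
    obtain ⟨q, hq, hqd, hqx⟩ := (hA x h0 h1).1 hxA
    have : eval x d = 0 := by
      have hdq : d ∈ q := Ideal.mem_of_dvd _
        (Finset.dvd_prod_of_mem e (by simp [hqd, hq])) (he q hq hqd)
      simpa [aeval_eq_eval] using hqx d hdq
    rw [this, mul_zero, mul_zero]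
  exact (hprime.mul_notMem (hX 0) (hprime.mul_notMem (hX 1) hd)) hmem

/-- A point is not cut out by one equation: f would divide both coordinate differences, so it would
have degree 0 in each variable and be a constant vanishing at the point. -/
theorem not_isMaximal_span_singleton {f : MvPolynomial (Fin 2) ℂ} :
    ¬ (Ideal.span {f}).IsMaximal := by
  intro hmax
  obtain ⟨x, hx⟩ := isMaximal_iff_eq_vanishingIdeal_singleton.1 hmax
  have hdvd : ∀ i, f ∣ X i - C (x i) := by
    intro i
    rw [← Ideal.mem_span_singleton, hx, mem_vanishingIdeal_singleton_iff]
    simp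
  have hne : ∀ i, (X i - C (x i) : MvPolynomial (Fin 2) ℂ) ≠ 0 := by
    intro i h
    have := congrArg (eval (fun _ => x i + 1)) h
    simp at this
  have hdeg : ∀ i, degreeOf i f = 0 := by
    intro i
    have hj : ∃ j, j ≠ i := exists_ne i
    obtain ⟨j, hj⟩ := hj
    obtain ⟨g, hg⟩ := hdvd j
    have hfg : f * g ≠ 0 := hg ▸ hne j
    have h1 := degreeOf_mul_eq (n := i) (left_ne_zero_of_mul hfg) (right_ne_zero_of_mul hfg)
    rw [← hg] at h1
    have h2 : degreeOf i (X j - C (x j) : MvPolynomial (Fin 2) ℂ) = 0 := by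
      have := degreeOf_sub_le i (X j : MvPolynomial (Fin 2) ℂ) (C (x j))
      rw [degreeOf_X, degreeOf_C, if_neg hj.symm] at this
      simpa using this
    omega
  have hconst : f = C (coeff 0 f) := by
    apply totalDegree_eq_zero_iff_eq_C.1
    rw [totalDegree_eq_zero_iff]
    intro m hm i
    have := monomial_le_degreeOf i hm
    rw [hdeg i] at this
    omega
  have hfx : eval x f = 0 := by
    have : f ∈ vanishingIdeal ℂ {x} := hx ▸ Ideal.mem_span_singleton_self f
    simpa [aeval_eq_eval] using this x rfl
  rw [hconst, eval_C] at hfx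
  rw [hconst, hfx] at hdvd
  simp only [map_zero, zero_dvd_iff] at hdvd
  exact hne 0 (hdvd 0)

/-- The substitution `μ ↦ -μ²`. -/
noncomputable def negSqSubst : MvPolynomial (Fin 2) ℂ →ₐ[ℂ] MvPolynomial (Fin 2) ℂ :=
  bind₁ ![X 0, -(X 1 ^ 2)]

theorem eval_negSqSubst (x : Fin 2 → ℂ) (P : MvPolynomial (Fin 2) ℂ) :
    eval x (negSqSubst P) = eval ![x 0, -(x 1 ^ 2)] P := by
  rw [negSqSubst, ← aeval_eq_eval, aeval_bind₁, ← aeval_eq_eval]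
  congr 2
  ext i
  fin_cases i <;> simp

/-- Integrality makes the contraction of a nonmaximal prime nonmaximal, so the image of a curve is
not a point. -/
theorem negSqSubst_isIntegral : negSqSubst.toRingHom.IsIntegral := by
  intro P
  have hX : ∀ i, negSqSubst.toRingHom.IsIntegralElem (X i) := by
    intro i
    fin_cases i
    · convert! RingHom.isIntegralElem_map negSqSubst.toRingHom (x := X 0)
      simp [negSqSubst]
    · refine ⟨Polynomial.X ^ 2 + Polynomial.C (X 1), by monicity!, ?_⟩
      simp [negSqSubst]
  induction P using MvPolynomial.induction_on with
  | C a =>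
    convert! RingHom.isIntegralElem_map negSqSubst.toRingHom (x := C a)
    simp [negSqSubst]
  | add p q hp hq => exact RingHom.IsIntegralElem.add _ hp hq
  | mul_X p i hp => exact RingHom.IsIntegralElem.mul _ hp (hX i)

theorem dvd_negSqSubst {B f : MvPolynomial (Fin 2) ℂ} {V : Set (Fin 2 → ℂ)}
    (hB : CutsOutCurves B V) (hV : ringKrullDim (ClosureCoordinateRing V) = 1)
    (hf : Irreducible f) (hX : ∀ i, (X i : MvPolynomial (Fin 2) ℂ) ∉ Ideal.span {f})
    (hle : ∀ h ∈ vanishingIdeal ℂ V, f ∣ negSqSubst h) : f ∣ negSqSubst B := by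
  have hprime : (Ideal.span {f}).IsPrime := (Ideal.span_singleton_prime hf.ne_zero).2 hf.prime
  let φ : MvPolynomial (Fin 2) ℂ →+* MvPolynomial (Fin 2) ℂ := negSqSubst
  let Q := (Ideal.span {f}).comap φ
  have hQmax : ¬ Q.IsMaximal := fun h => not_isMaximal_span_singleton
    (Ideal.isMaximal_of_isIntegral_of_isMaximal_comap' φ negSqSubst_isIntegral _ h)
  -- The component q contains the image curve. Its dimension is at most that of V, and at least 1
  -- because the chain q ≤ Q < M is strict at M.
  obtain ⟨q, hq, hqQ⟩ := Ideal.exists_minimalPrimes_le (I := vanishingIdeal ℂ V) (J := Q)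
    (fun h hh => Ideal.mem_span_singleton.2 (hle h hh))
  have hqp : q.IsPrime := hq.1.1
  have hdim : ringKrullDim (MvPolynomial (Fin 2) ℂ ⧸ q) = 1 := by
    refine le_antisymm ?_ ?_
    · rw [← hV]
      exact ringKrullDim_le_of_surjective (Ideal.Quotient.factor hq.1.2)
        (Ideal.Quotient.factor_surjective hq.1.2)
    · rw [ringKrullDim_quotient, Order.one_le_krullDim_iff]
      obtain ⟨M, hM, hQM⟩ := Ideal.exists_le_maximal Q (Ideal.IsPrime.ne_top inferInstance)
      refine ⟨⟨⟨q, hqp⟩, le_refl q⟩, ⟨⟨M, hM.isPrime⟩, hqQ.trans hQM⟩, ?_⟩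
      change q < M
      refine lt_of_le_of_lt hqQ (lt_of_le_of_ne hQM ?_)
      rintro rfl
      exact hQmax hM
  rw [← Ideal.mem_span_singleton]
  have hmem : X 0 * (X 1 * negSqSubst B) ∈ Ideal.span {f} := by
    apply mem_of_forall_mem_zeroLocus
    intro x hx
    rw [map_mul, map_mul, eval_X, eval_X]
    by_cases h0 : x 0 = 0
    · simp [h0]
    by_cases h1 : x 1 = 0
    · simp [h1]
    have : eval x (negSqSubst B) = 0 := by
      rw [eval_negSqSubst]
      refine (hB _ (by simpa using h0) (by simpa using h1)).2 ⟨q, hq, hdim, ?_⟩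
      intro g hg
      have := hx _ (hqQ hg)
      rw [aeval_eq_eval] at this ⊢
      exact (eval_negSqSubst x g).symm.trans this
    rw [this, mul_zero, mul_zero]
  exact ((hprime.mem_or_mem hmem).resolve_left (hX 0) |> hprime.mem_or_mem).resolve_left (hX 1)

theorem irreducible_one_add_C_mul_X {c : ℂ} (hc : c ≠ 0) :
    Irreducible (1 + C c * X 1 : MvPolynomial (Fin 2) ℂ) := by
  have hco : coeff (Finsupp.single 1 1) (1 + C c * X 1 : MvPolynomial (Fin 2) ℂ) = c := by
    rw [coeff_add, coeff_C_mul, coeff_X, coeff_one, if_neg (by simp [Finsupp.ext_iff])]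
    simp
  apply irreducible_of_totalDegree_eq_one
  · apply le_antisymm
    · refine (totalDegree_add _ _).trans ?_
      refine max_le (by simp) ((totalDegree_mul _ _).trans (by simp))
    · have hm : Finsupp.single 1 1 ∈ (1 + C c * X 1 : MvPolynomial (Fin 2) ℂ).support := by
        rw [mem_support_iff, hco]; exact hc
      simpa using le_totalDegree hm
  · intro x hx
    exact isUnit_of_dvd_unit (hx (Finsupp.single 1 1)) (by rw [hco]; exact hc.isUnit)

theorem dvd_of_squarefree {R : Type*} [CommRing R] [IsDomain R] [UniqueFactorizationMonoid R]
    {a b : R} (ha : Squarefree a) (h : ∀ f, Irreducible f → f ∣ a → f ∣ b) : a ∣ b := by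
  have ha0 : a ≠ 0 := ha.ne_zero
  induction a using WfDvdMonoid.induction_on_irreducible with
  | zero => exact absurd rfl ha0
  | unit u hu => exact hu.dvd
  | mul a i ha' hi ih =>
    rw [squarefree_mul_iff] at ha
    exact ha.1.mul_dvd (h i hi (dvd_mul_right _ _))
      (ih ha.2.2 (fun f hf hfa => h f hf (hfa.mul_left _)) ha')

theorem one_sub_X_sq_mul_dvd {E V : Set (Fin 2 → ℂ)} {A B : MvPolynomial (Fin 2) ℂ}
    (hA : CutsOutCurves A E) (hsq : Squarefree A) (hX : ∀ i : Fin 2, ¬ X i ∣ A)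
    (hB : CutsOutCurves B V) (hV : ringKrullDim (ClosureCoordinateRing V) = 1)
    (hEV : ∀ x ∈ E, x 1 ^ 2 ≠ 1 → ![x 0, -(x 1 ^ 2)] ∈ V)
    (hE : ∀ x ∈ E, x 1 ^ 2 = 1 → x 0 ^ 2 = 1)
    (hneg : ∀ x : Fin 2 → ℂ, x 0 ≠ 0 → x 1 = -1 → x ∈ V) :
    (1 - X 1 ^ 2) * A ∣ negSqSubst B := by
  have hfac : (1 - X 1 ^ 2 : MvPolynomial (Fin 2) ℂ) =
      (1 + C 1 * X 1) * (1 + C (-1) * X 1) := by simp; ring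
  have hirr : ∀ c : ℂ, c ^ 2 = 1 → Irreducible (1 + C c * X 1 : MvPolynomial (Fin 2) ℂ) := by
    intro c hc
    exact irreducible_one_add_C_mul_X (by rintro rfl; simp at hc)
  have hXnot : ∀ c : ℂ, c ^ 2 = 1 → ∀ i,
      (X i : MvPolynomial (Fin 2) ℂ) ∉ Ideal.span {(1 + C c * X 1 : MvPolynomial (Fin 2) ℂ)} := by
    intro c hc i hi
    obtain ⟨g, hg⟩ := Ideal.mem_span_singleton.1 hi
    have := congrArg (eval ![1, -c]) hg
    have hc0 : c ≠ 0 := by rintro rfl; simp at hc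
    have hcc : 1 + -(c * c) = 0 := by linear_combination -hc
    fin_cases i <;> simp at this <;> rw [hcc, zero_mul] at this <;> simp [hc0] at this
  have hlin : ∀ c : ℂ, c ^ 2 = 1 → (1 + C c * X 1 : MvPolynomial (Fin 2) ℂ) ∣ negSqSubst B := by
    intro c hc
    refine dvd_negSqSubst hB hV (hirr c hc) (hXnot c hc) ?_
    intro h hh
    have hprime : (Ideal.span {(1 + C c * X 1 : MvPolynomial (Fin 2) ℂ)}).IsPrime :=
      (Ideal.span_singleton_prime (hirr c hc).ne_zero).2 (hirr c hc).prime
    have hmem : X 0 * negSqSubst h ∈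
        Ideal.span {(1 + C c * X 1 : MvPolynomial (Fin 2) ℂ)} := by
      apply mem_of_forall_mem_zeroLocus
      intro x hx
      rw [map_mul, eval_X]
      by_cases h0 : x 0 = 0
      · simp [h0]
      have h1 := hx _ (Ideal.mem_span_singleton_self _)
      simp at h1
      have h1' : x 1 ^ 2 = 1 := by linear_combination (c * x 1 - 1) * h1 - x 1 ^ 2 * hc
      rw [eval_negSqSubst]
      have := hh _ (hneg ![x 0, -(x 1 ^ 2)] (by simpa using h0) (by simp [h1']))
      rw [aeval_eq_eval] at this
      rw [show eval ![x 0, -(x 1 ^ 2)] h = 0 from this, mul_zero]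
    exact Ideal.mem_span_singleton.1 ((hprime.mem_or_mem hmem).resolve_left (hXnot c hc 0))
  have hndvd : ∀ c : ℂ, c ^ 2 = 1 → ¬ (1 + C c * X 1 : MvPolynomial (Fin 2) ℂ) ∣ A := by
    intro c hc hdvd
    have hmin := span_mem_minimalPrimes hA (hirr c hc) hdvd (hXnot c hc)
    have hmem : (X 0 ^ 2 - 1 : MvPolynomial (Fin 2) ℂ) ∈
        Ideal.span {(1 + C c * X 1 : MvPolynomial (Fin 2) ℂ)} := by
      refine mem_minimalPrime_vanishingIdeal hmin (g := 1)
        ((Ideal.ne_top_iff_one _).1 hmin.1.1.ne_top) ?_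
      intro x hx hxp _
      have h1 := hxp _ (Ideal.mem_span_singleton_self _)
      simp at h1
      have h1' : x 1 ^ 2 = 1 := by linear_combination (c * x 1 - 1) * h1 - x 1 ^ 2 * hc
      simp [hE x hx h1']
    obtain ⟨g, hg⟩ := Ideal.mem_span_singleton.1 hmem
    -- A point of the line with λ² ≠ 1.
    have := congrArg (eval ![2, -c]) hg
    have hcc : 1 + -(c * c) = 0 := by linear_combination -hc
    simp at this
    rw [hcc, zero_mul] at this
    norm_num at this
  have hsq' : Squarefree ((1 - X 1 ^ 2) * A) := by
    have h1 := hirr 1 (by norm_num)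
    have h2 := hirr (-1) (by norm_num)
    rw [hfac, mul_assoc, squarefree_mul_iff, squarefree_mul_iff]
    have h12 : ¬ (1 + C 1 * X 1 : MvPolynomial (Fin 2) ℂ) ∣ (1 + C (-1) * X 1) := by
      rintro ⟨g, hg⟩
      have := congrArg (eval ![1, -1]) hg
      norm_num at this
    refine ⟨h1.isRelPrime_iff_not_dvd.2 fun h => ?_, h1.squarefree,
      h2.isRelPrime_iff_not_dvd.2 (hndvd _ (by norm_num)), h2.squarefree, hsq⟩
    exact (h1.prime.dvd_or_dvd h).elim h12 (hndvd _ (by norm_num))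
  refine dvd_of_squarefree hsq' ?_
  intro f hf hfd
  rw [hfac] at hfd
  have hassoc : ∀ c : ℂ, c ^ 2 = 1 → f ∣ (1 + C c * X 1) → f ∣ negSqSubst B :=
    fun c hc hfc => hfc.trans (hlin c hc)
  rcases hf.prime.dvd_or_dvd hfd with h | hfA
  · exact (hf.prime.dvd_or_dvd h).elim (hassoc _ (by norm_num)) (hassoc _ (by norm_num))
  have hprime : (Ideal.span {f}).IsPrime := (Ideal.span_singleton_prime hf.ne_zero).2 hf.prime
  have hfX : ∀ i, (X i : MvPolynomial (Fin 2) ℂ) ∉ Ideal.span {f} := by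
    intro i hi
    have hXi : Irreducible (X i : MvPolynomial (Fin 2) ℂ) := (X_prime (i := i)).irreducible
    exact hX i ((hf.dvd_symm hXi (Ideal.mem_span_singleton.1 hi)).trans hfA)
  have hflin : (1 - X 1 ^ 2 : MvPolynomial (Fin 2) ℂ) ∉ Ideal.span {f} := by
    rw [Ideal.mem_span_singleton, hfac]
    intro h
    rcases hf.prime.dvd_or_dvd h with h | h
    · exact hndvd 1 (by norm_num) ((hf.dvd_symm (hirr 1 (by norm_num)) h).trans hfA)
    · exact hndvd (-1) (by norm_num) ((hf.dvd_symm (hirr (-1) (by norm_num)) h).trans hfA)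
  have hmin := span_mem_minimalPrimes hA hf hfA hfX
  refine dvd_negSqSubst hB hV hf hfX ?_
  intro h hh
  rw [← Ideal.mem_span_singleton]
  -- Points with μ² = 1, where the construction of augmentations fails, are discarded; they do not
  -- fill the curve f = 0.
  refine mem_minimalPrime_vanishingIdeal hmin hflin ?_
  intro x hx _ hxg
  rw [eval_negSqSubst]
  refine hh _ (hEV x hx ?_)
  intro h1
  simp [h1] at hxg

end MvPolynomial

/-! ### Spheres as suspensions, logarithms, and trivial line bundles. -/

section Suspension

open unitInterval Module

variable {E : Type*} [NormedAddCommGroup E] [InnerProductSpace ℝ E]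

theorem norm_cos_smul_add_sin_smul {n w : E} (hn : ‖n‖ = 1) (hw : ‖w‖ = 1)
    (hnw : inner ℝ n w = 0) (t : ℝ) : ‖Real.cos t • n + Real.sin t • w‖ = 1 := by
  have h : ‖Real.cos t • n + Real.sin t • w‖ ^ 2 = 1 := by
    rw [norm_add_sq_real, norm_smul, norm_smul, hn, hw, inner_smul_left, inner_smul_right, hnw]
    simp
  exact (pow_eq_one_iff_of_nonneg (norm_nonneg _) two_ne_zero).1 h

/-- The unit sphere as the unreduced suspension of an equator. -/
noncomputable def suspensionMap (n : Metric.sphere (0 : E) 1)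
    (p : I × Metric.sphere (0 : (ℝ ∙ (n : E))ᗮ) 1) : Metric.sphere (0 : E) 1 :=
  ⟨Real.cos (Real.pi * p.1) • (n : E) + Real.sin (Real.pi * p.1) • ((p.2 : (ℝ ∙ (n : E))ᗮ) : E), by
    rw [mem_sphere_zero_iff_norm]
    apply norm_cos_smul_add_sin_smul (norm_eq_of_mem_sphere n)
    · exact norm_eq_of_mem_sphere p.2
    · exact (Submodule.mem_orthogonal_singleton_iff_inner_right).1 (p.2 : (ℝ ∙ (n : E))ᗮ).2⟩

theorem continuous_suspensionMap (n : Metric.sphere (0 : E) 1) :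
    Continuous (suspensionMap n) := by
  unfold suspensionMap
  fun_prop

theorem suspensionMap_zero (n : Metric.sphere (0 : E) 1) (u) : suspensionMap n (0, u) = n := by
  ext; simp [suspensionMap]

theorem suspensionMap_one (n : Metric.sphere (0 : E) 1) (u) : suspensionMap n (1, u) = -n := by
  ext; simp [suspensionMap]

theorem suspensionMap_surjective [FiniteDimensional ℝ E] (h : 2 ≤ finrank ℝ E)
    (n : Metric.sphere (0 : E) 1) : Function.Surjective (suspensionMap n) := by
  intro x
  have hn : ‖(n : E)‖ = 1 := norm_eq_of_mem_sphere n
  have hx : ‖(x : E)‖ = 1 := norm_eq_of_mem_sphere x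
  set c : ℝ := inner ℝ (n : E) (x : E) with hc
  have hc1 : |c| ≤ 1 := by simpa [hn, hx] using abs_real_inner_le_norm (n : E) (x : E)
  rw [abs_le] at hc1
  let w : (ℝ ∙ (n : E))ᗮ := ⟨(x : E) - c • (n : E), by
    rw [Submodule.mem_orthogonal_singleton_iff_inner_right, inner_sub_right, inner_smul_right,
      real_inner_self_eq_norm_sq, hn, ← hc]
    ring⟩
  have hw : ‖w‖ = √(1 - c ^ 2) := by
    rw [eq_comm, Real.sqrt_eq_iff_mul_self_eq (by nlinarith) (norm_nonneg _), ← sq]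
    change 1 - c ^ 2 = ‖(x : E) - c • (n : E)‖ ^ 2
    rw [norm_sub_sq_real, norm_smul, inner_smul_right, real_inner_comm, ← hc, hn, hx]
    simp only [Real.norm_eq_abs, mul_one, sq_abs]
    ring
  let t : I := ⟨Real.arccos c / Real.pi, div_nonneg (Real.arccos_nonneg _) Real.pi_pos.le,
    (div_le_one Real.pi_pos).2 (Real.arccos_le_pi _)⟩
  have ht : Real.pi * (t : ℝ) = Real.arccos c := mul_div_cancel₀ _ Real.pi_ne_zero
  have key : ∀ u : Metric.sphere (0 : (ℝ ∙ (n : E))ᗮ) 1, √(1 - c ^ 2) • (u : (ℝ ∙ (n : E))ᗮ) = w →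
      suspensionMap n (t, u) = x := by
    intro u hu
    ext
    change Real.cos (Real.pi * t) • (n : E) + Real.sin (Real.pi * t) • _ = _
    rw [ht, Real.cos_arccos hc1.1 hc1.2, Real.sin_arccos, ← Submodule.coe_smul, hu]
    simp [w]
  -- At the poles any equatorial point serves, so the equator only has to be nonempty.
  by_cases hw0 : w = 0
  · have hfr : 0 < finrank ℝ (ℝ ∙ (n : E))ᗮ := by
      have := Submodule.finrank_add_finrank_orthogonal (ℝ ∙ (n : E))
      rw [finrank_span_singleton (norm_ne_zero_iff.1 (by rw [hn]; exact one_ne_zero))] at this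
      omega
    have : Nontrivial (ℝ ∙ (n : E))ᗮ := Module.nontrivial_of_finrank_pos hfr
    obtain ⟨u, hu⟩ := NormedSpace.sphere_nonempty (x := (0 : (ℝ ∙ (n : E))ᗮ)) (r := 1) |>.2
      zero_le_one
    refine ⟨(t, ⟨u, hu⟩), key _ ?_⟩
    rw [← hw, hw0, norm_zero, zero_smul]
  · refine ⟨(t, ⟨‖w‖⁻¹ • w, ?_⟩), key _ ?_⟩
    · rw [mem_sphere_zero_iff_norm, norm_smul, norm_inv, norm_norm,
        inv_mul_cancel₀ (norm_ne_zero_iff.2 hw0)]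
    · rw [← hw]
      exact smul_inv_smul₀ (norm_ne_zero_iff.2 hw0) w

theorem suspensionMap_eq {n : Metric.sphere (0 : E) 1}
    {p p' : I × Metric.sphere (0 : (ℝ ∙ (n : E))ᗮ) 1}
    (h : suspensionMap n p = suspensionMap n p') :
    p.1 = p'.1 ∧ (p.1 = 0 ∨ p.1 = 1 ∨ p.2 = p'.2) := by
  have hn : ‖(n : E)‖ = 1 := norm_eq_of_mem_sphere n
  have hE := congrArg Subtype.val h
  change Real.cos (Real.pi * p.1) • (n : E) + Real.sin (Real.pi * p.1) • _ =
    Real.cos (Real.pi * p'.1) • (n : E) + Real.sin (Real.pi * p'.1) • _ at hE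
  have horth : ∀ u : (ℝ ∙ (n : E))ᗮ, inner ℝ (n : E) (u : E) = 0 := fun u =>
    (Submodule.mem_orthogonal_singleton_iff_inner_right).1 u.2
  have hcos : Real.cos (Real.pi * p.1) = Real.cos (Real.pi * p'.1) := by
    have := congrArg (fun z => inner ℝ (n : E) z) hE
    simpa [inner_add_right, inner_smul_right, horth, real_inner_self_eq_norm_sq, hn] using this
  have hmem : ∀ t : I, Real.pi * (t : ℝ) ∈ Set.Icc 0 Real.pi := fun t =>
    ⟨mul_nonneg Real.pi_pos.le t.2.1, mul_le_of_le_one_right Real.pi_pos.le t.2.2⟩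
  have h1 : p.1 = p'.1 := by
    have := Real.injOn_cos (hmem p.1) (hmem p'.1) hcos
    exact Subtype.ext (mul_left_cancel₀ Real.pi_ne_zero this)
  refine ⟨h1, ?_⟩
  by_cases h0 : p.1 = 0
  · exact Or.inl h0
  by_cases h2 : p.1 = 1
  · exact Or.inr (Or.inl h2)
  right; right
  rw [← h1] at hE
  have hs : Real.sin (Real.pi * p.1) ≠ 0 := by
    apply ne_of_gt
    apply Real.sin_pos_of_pos_of_lt_pi
    · exact mul_pos Real.pi_pos (lt_of_le_of_ne p.1.2.1 (fun h => h0 (Subtype.ext h.symm)))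
    · exact mul_lt_of_lt_one_right Real.pi_pos
        (lt_of_le_of_ne p.1.2.2 (fun h => h2 (Subtype.ext h)))
  exact Subtype.ext (Subtype.ext (smul_right_injective _ hs (add_left_cancel hE)))

/-- The suspension map is a quotient map, being a closed continuous surjection, and it only
identifies points at the two ends. -/
theorem exists_continuousMap_sphere_of_suspension [FiniteDimensional ℝ E] (h : 2 ≤ finrank ℝ E)
    {Z : Type*} [TopologicalSpace Z] (n : Metric.sphere (0 : E) 1)
    (f : C(I × Metric.sphere (0 : (ℝ ∙ (n : E))ᗮ) 1, Z)) {a b : Z}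
    (h0 : ∀ u, f (0, u) = a) (h1 : ∀ u, f (1, u) = b) :
    ∃ g : C(Metric.sphere (0 : E) 1, Z), ∀ p, g (suspensionMap n p) = f p := by
  have hq : Topology.IsQuotientMap (suspensionMap n) :=
    (continuous_suspensionMap n).isClosedMap.isQuotientMap (continuous_suspensionMap n)
      (suspensionMap_surjective h n)
  have hf : ∀ p p', suspensionMap n p = suspensionMap n p' → f p = f p' := by
    rintro ⟨t, u⟩ ⟨t', u'⟩ hp
    obtain ⟨ht, h⟩ := suspensionMap_eq hp
    dsimp only at ht h
    subst ht
    rcases h with rfl | rfl | rfl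
    · rw [h0, h0]
    · rw [h1, h1]
    · rfl
  let q : C(I × Metric.sphere (0 : (ℝ ∙ (n : E))ᗮ) 1, Metric.sphere (0 : E) 1) :=
    ⟨suspensionMap n, continuous_suspensionMap n⟩
  refine ⟨Topology.IsQuotientMap.lift (f := q) hq f hf, fun p => ?_⟩
  exact DFunLike.congr_fun (Topology.IsQuotientMap.lift_comp (f := q) hq f hf) p

theorem finrank_orthogonal_sphere [FiniteDimensional ℝ E] (n : Metric.sphere (0 : E) 1) :
    finrank ℝ (ℝ ∙ (n : E))ᗮ + 1 = finrank ℝ E := by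
  have hn : ‖(n : E)‖ = 1 := norm_eq_of_mem_sphere n
  have := Submodule.finrank_add_finrank_orthogonal (ℝ ∙ (n : E))
  rw [finrank_span_singleton (norm_ne_zero_iff.1 (by rw [hn]; exact one_ne_zero))] at this
  omega

/-- A nowhere vanishing function on a sphere of dimension at least two has a logarithm. -/
theorem exists_log_sphere [FiniteDimensional ℝ E] (h : 3 ≤ finrank ℝ E)
    (c : C(Metric.sphere (0 : E) 1, {z : ℂ // z ≠ 0})) :
    ∃ ℓ : C(Metric.sphere (0 : E) 1, ℂ), ∀ x, Complex.exp (ℓ x) = c x := by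
  have : Nontrivial E := Module.nontrivial_of_finrank_pos (R := ℝ) (by omega)
  obtain ⟨n, hn⟩ := NormedSpace.sphere_nonempty (x := (0 : E)) (r := 1) |>.2 zero_le_one
  let n : Metric.sphere (0 : E) 1 := ⟨n, hn⟩
  have hconn : PreconnectedSpace (Metric.sphere (0 : (ℝ ∙ (n : E))ᗮ) 1) := by
    have hfr := finrank_orthogonal_sphere n
    refine Subtype.preconnectedSpace (isPreconnected_sphere ?_ _ _)
    rw [← Module.finrank_eq_rank]
    exact_mod_cast (by omega : 1 < finrank ℝ (ℝ ∙ (n : E))ᗮ)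
  let cov := Complex.isCoveringMap_exp
  let q : C(I × Metric.sphere (0 : (ℝ ∙ (n : E))ᗮ) 1, Metric.sphere (0 : E) 1) :=
    ⟨suspensionMap n, continuous_suspensionMap n⟩
  let L := cov.liftHomotopy (c.comp q) (.const _ (Complex.log (c n))) (by
    intro a
    apply Subtype.ext
    change ((c (suspensionMap n (0, a)) : {z : ℂ // z ≠ 0}) : ℂ) = Complex.exp (Complex.log (c n))
    rw [suspensionMap_zero, Complex.exp_log (c n).2])
  have hL : ∀ p, Complex.exp (L p) = c (suspensionMap n p) := fun p =>
    congrArg Subtype.val (congrFun (cov.liftHomotopy_lifts (c.comp q) _ _) p)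
  have hL0 : ∀ u, L (0, u) = Complex.log (c n) := fun u => cov.liftHomotopy_zero _ _ _ u
  -- On the end over -n the logarithm lifts a constant map from a connected equator, so it is
  -- constant.
  have hL1 : ∀ u u', L (1, u) = L (1, u') := by
    intro u u'
    refine congrFun (?_ : (fun v => L (1, v)) = fun _ => L (1, u')) u
    refine cov.eq_of_comp_eq (by fun_prop) continuous_const ?_ u' rfl
    ext v
    change Complex.exp (L (1, v)) = Complex.exp (L (1, u'))
    rw [hL, hL, suspensionMap_one, suspensionMap_one]
  obtain ⟨p₁, -⟩ := suspensionMap_surjective (by omega) n n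
  obtain ⟨ℓ, hℓ⟩ := exists_continuousMap_sphere_of_suspension (by omega) n L hL0
    (fun u => hL1 u p₁.2)
  refine ⟨ℓ, fun x => ?_⟩
  obtain ⟨p, rfl⟩ := suspensionMap_surjective (by omega) n x
  rw [hℓ, hL]

variable {W : Type*} [NormedAddCommGroup W] [NormedSpace ℂ W]

theorem exists_dist_lt_one_of_compact {A Z : Type*} [TopologicalSpace A] [CompactSpace A]
    [PseudoMetricSpace Z] (P : C(I × A, Z)) :
    ∃ N : ℕ, 0 < N ∧ ∀ (a : A) (s s' : I), |(s : ℝ) - s'| ≤ 1 / N →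
      dist (P (s, a)) (P (s', a)) < 1 := by
  have huc := CompactSpace.uniformContinuous_of_continuous P.curry.continuous
  obtain ⟨δ, hδ, hd⟩ := Metric.uniformContinuous_iff.1 huc 1 one_pos
  obtain ⟨N, hN⟩ := exists_nat_one_div_lt hδ
  refine ⟨N + 1, N.succ_pos, fun a s s' hs => ?_⟩
  refine lt_of_le_of_lt (ContinuousMap.dist_apply_le_dist (f := P.curry s) (g := P.curry s') a)
    (hd (lt_of_le_of_lt ?_ hN))
  exact_mod_cast hs

/-- The vector w is carried along by projecting it successively with P at finitely many close times.
A projection at distance less than 1 from another cannot kill a nonzero vector fixed by the other.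
-/
theorem exists_transport {A : Type*} [TopologicalSpace A] [CompactSpace A]
    (P : C(I × A, W →L[ℂ] W)) (hP : ∀ p v, P p (P p v) = P p v) (w : W) (hw0 : w ≠ 0)
    (hw : ∀ a, P (0, a) w = w) :
    ∃ v : C(I × A, W), (∀ a, v (0, a) = w) ∧ ∀ p, v p ≠ 0 ∧ P p (v p) = v p := by
  obtain ⟨N, hN, hclose⟩ := exists_dist_lt_one_of_compact P
  -- At time t the stops are tk/N; the truncation at 1 keeps them in the interval for every k, and
  -- the Nth stop is t itself.
  let τ : ℕ → I → I := fun k t => ⟨t * min ((k : ℝ) / N) 1, mul_nonneg t.2.1 (by positivity),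
    mul_le_one₀ t.2.2 (by positivity) (min_le_right _ _)⟩
  have hτ : ∀ k, Continuous (τ k) := by
    intro k
    unfold τ
    fun_prop
  let V : ℕ → I × A → W := fun k => Nat.rec (fun _ => w) (fun k v p => P (τ (k + 1) p.1, p.2) (v p)) k
  have hVs : ∀ k p, V (k + 1) p = P (τ (k + 1) p.1, p.2) (V k p) := fun _ _ => rfl
  have hVc : ∀ k, Continuous (V k) := by
    intro k
    induction k with
    | zero => exact continuous_const
    | succ k ih =>
      have : Continuous fun p : I × A => P (τ (k + 1) p.1, p.2) :=
        P.continuous.comp (((hτ _).comp continuous_fst).prodMk continuous_snd)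
      exact this.clm_apply ih
  have hτ0 : ∀ k, τ k 0 = 0 := fun k => by ext; simp [τ]
  have hτz : ∀ t, τ 0 t = 0 := fun t => by ext; simp [τ]
  have hτN : ∀ t, τ N t = t := fun t => by ext; simp [τ, hN.ne']
  have hV0 : ∀ k a, V k (0, a) = w := by
    intro k a
    induction k with
    | zero => rfl
    | succ k ih => rw [hVs, ih, hτ0, hw]
  have hVP : ∀ k p, V k p ≠ 0 ∧ P (τ k p.1, p.2) (V k p) = V k p := by
    intro k p
    induction k with
    | zero => exact ⟨hw0, by rw [hτz]; exact hw p.2⟩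
    | succ k ih =>
      rw [hVs]
      refine ⟨fun h0 => ?_, hP _ _⟩
      have hlt : ‖P (τ k p.1, p.2) - P (τ (k + 1) p.1, p.2)‖ < 1 := by
        rw [← dist_eq_norm]
        apply hclose
        simp only [τ]
        rw [← mul_sub, abs_mul]
        have h1 : |min ((k : ℝ) / N) 1 - min (((k + 1 : ℕ) : ℝ) / N) 1| ≤ 1 / N := by
          refine (abs_min_sub_min_le_max _ _ _ _).trans (max_le ?_ (by simp))
          rw [← sub_div, abs_div]
          simp
        exact (mul_le_of_le_one_left (abs_nonneg _)
          (abs_le.2 ⟨by linarith [p.1.2.1], p.1.2.2⟩)).trans h1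
      have hle := (P (τ k p.1, p.2) - P (τ (k + 1) p.1, p.2)).le_opNorm (V k p)
      rw [sub_apply, ih.2, h0, sub_zero] at hle
      have hpos := norm_pos_iff.2 ih.1
      nlinarith
  exact ⟨⟨V N, hVc N⟩, hV0 N, fun p => by simpa [hτN] using hVP N p⟩

/-- A continuous family of rank one projections over a sphere of dimension at least three has
a nowhere vanishing section: complex line bundles over such spheres are trivial. -/
theorem exists_section_sphere [FiniteDimensional ℝ E] (h : 4 ≤ finrank ℝ E)
    (P : C(Metric.sphere (0 : E) 1, W →L[ℂ] W))
    (hP : ∀ x, ∃ (w : W) (φ : W →L[ℂ] ℂ), φ w = 1 ∧ ∀ v, P x v = φ v • w) :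
    ∃ v : C(Metric.sphere (0 : E) 1, W), ∀ x, v x ≠ 0 ∧ P x (v x) = v x := by
  have : Nontrivial E := Module.nontrivial_of_finrank_pos (R := ℝ) (by omega)
  obtain ⟨n, hn⟩ := NormedSpace.sphere_nonempty (x := (0 : E)) (r := 1) |>.2 zero_le_one
  let n : Metric.sphere (0 : E) 1 := ⟨n, hn⟩
  have hidem : ∀ x v, P x (P x v) = P x v := by
    intro x v
    obtain ⟨w, φ, hφ, hPx⟩ := hP x
    rw [hPx, hPx, map_smul, hφ, smul_eq_mul, mul_one]
  let q : C(I × Metric.sphere (0 : (ℝ ∙ (n : E))ᗮ) 1, Metric.sphere (0 : E) 1) :=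
    ⟨suspensionMap n, continuous_suspensionMap n⟩
  have hq0 : ∀ u, q (0, u) = n := suspensionMap_zero n
  have hq1 : ∀ u, q (1, u) = -n := suspensionMap_one n
  obtain ⟨w, φ, hφ, hPn⟩ := hP n
  obtain ⟨w', φ', hφ', hPn'⟩ := hP (-n)
  obtain ⟨v, hv0, hv⟩ := exists_transport (P.comp q) (fun p => hidem _) w
    (by rintro rfl; simp at hφ)
    (fun u => by rw [ContinuousMap.comp_apply, hq0, hPn, hφ, one_smul])
  have hv1 : ∀ u, v (1, u) = φ' (v (1, u)) • w' := by
    intro u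
    rw [← hPn', ← hq1 u]
    exact (hv (1, u)).2.symm
  let c : C(Metric.sphere (0 : (ℝ ∙ (n : E))ᗮ) 1, {z : ℂ // z ≠ 0}) :=
    ⟨fun u => ⟨φ' (v (1, u)), fun h0 => (hv (1, u)).1 (by rw [hv1, h0, zero_smul])⟩, by fun_prop⟩
  -- The transported vectors arrive over -n as different multiples of w'. The equator has dimension
  -- at least two, so the factor has a logarithm ℓ; rescaling by exp(-tℓ) makes all of them arrive
  -- at w'.
  obtain ⟨ℓ, hℓ⟩ := exists_log_sphere (by have := finrank_orthogonal_sphere n; omega) c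
  let f : C(I × Metric.sphere (0 : (ℝ ∙ (n : E))ᗮ) 1, W) :=
    ⟨fun p => Complex.exp (-((p.1 : ℝ) : ℂ) * ℓ p.2) • v p, by fun_prop⟩
  obtain ⟨g, hg⟩ := exists_continuousMap_sphere_of_suspension (by omega) n f (a := w) (b := w')
    (fun u => by simp [f, hv0]) (fun u => by
      simp only [f, ContinuousMap.coe_mk]
      rw [hv1 u, smul_smul, show φ' (v (1, u)) = Complex.exp (ℓ u) from (hℓ u).symm,
        ← Complex.exp_add]
      simp)
  refine ⟨g, fun x => ?_⟩
  obtain ⟨p, rfl⟩ := suspensionMap_surjective (by omega) n x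
  rw [hg]
  refine ⟨smul_ne_zero (Complex.exp_ne_zero _) (hv p).1, ?_⟩
  change P (q p) (Complex.exp _ • v p) = Complex.exp _ • v p
  rw [map_smul]
  congr 1
  exact (hv p).2

end Suspension

/-! ### The line bundle of the knot and linking numbers. -/

/-- The image of the support is compact, hence closed, so the extension vanishes near every point
outside the range. -/
theorem continuous_extend_of_hasCompactSupport {X Y Z : Type*} [TopologicalSpace X] [T2Space X]
    [TopologicalSpace Y] [TopologicalSpace Z] [Zero Z] {e : Y → X}
    (he : Topology.IsOpenEmbedding e) {g : Y → Z} (hg : Continuous g)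
    (hc : HasCompactSupport g) : Continuous (Function.extend e g 0) := by
  rw [continuous_iff_continuousAt]
  intro x
  by_cases hx : x ∈ Set.range e
  · obtain ⟨y, rfl⟩ := hx
    rw [he.continuousAt_iff.symm]
    have : Function.extend e g 0 ∘ e = g := Function.extend_comp he.injective g 0
    rw [this]
    exact hg.continuousAt
  · have hcl : IsClosed (e '' tsupport g) := (hc.isCompact.image he.continuous).isClosed
    have hmem : (e '' tsupport g)ᶜ ∈ nhds x := hcl.isOpen_compl.mem_nhds
      (fun ⟨y, _, hy⟩ => hx ⟨y, hy⟩)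
    refine (continuousAt_const (y := (0 : Z))).congr ?_
    filter_upwards [hmem] with x' hx'
    by_cases hr : x' ∈ Set.range e
    · obtain ⟨y, rfl⟩ := hr
      rw [he.injective.extend_apply]
      exact (image_eq_zero_of_notMem_tsupport (fun hy => hx' ⟨y, hy, rfl⟩)).symm
    · rw [Function.extend_apply' _ _ _ hr]
      rfl

section LineProjection

/-- The height of the line over the point `z` of the plane. -/
noncomputable def bump (z : ℂ) : ℂ := ((max 0 (1 - ‖z‖) : ℝ) : ℂ)

theorem bump_zero : bump 0 = 1 := by simp [bump]

theorem bump_of_one_le {z : ℂ} (hz : 1 ≤ ‖z‖) : bump z = 0 := by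
  simp [bump, hz]

/-- It is never zero, it spans the fixed line through (1, 0) once ‖z‖ ≥ 1, and its first coordinate
vanishes only at z = 0, to first order. -/
noncomputable def lineVector (z : ℂ) : ℂ × ℂ := (z, bump z)

noncomputable def lineDenominator (z : ℂ) : ℂ := star z * z + star (bump z) * bump z

theorem lineDenominator_ne_zero (z : ℂ) : lineDenominator z ≠ 0 := by
  by_cases hz : z = 0
  · simp [hz, lineDenominator, bump_zero]
  · have h1 : lineDenominator z = ((Complex.normSq z + Complex.normSq (bump z) : ℝ) : ℂ) := by
      simp [lineDenominator, Complex.normSq_eq_conj_mul_self]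
    rw [h1, Complex.ofReal_ne_zero]
    exact (add_pos_of_pos_of_nonneg (Complex.normSq_pos.2 hz) (Complex.normSq_nonneg _)).ne'

/-- The coordinate on the line spanned by `lineVector z`, extended orthogonally. -/
noncomputable def lineCoordinate (z : ℂ) : ℂ × ℂ →L[ℂ] ℂ :=
  (lineDenominator z)⁻¹ • (star z • ContinuousLinearMap.fst ℂ ℂ ℂ +
    star (bump z) • ContinuousLinearMap.snd ℂ ℂ ℂ)

theorem lineCoordinate_lineVector (z : ℂ) : lineCoordinate z (lineVector z) = 1 := by
  have := lineDenominator_ne_zero z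
  simp only [lineCoordinate, lineVector, smul_apply, add_apply, ContinuousLinearMap.coe_fst',
    ContinuousLinearMap.coe_snd', smul_eq_mul]
  exact inv_mul_cancel₀ this

theorem continuous_bump : Continuous bump := by unfold bump; fun_prop

theorem continuous_lineVector : Continuous lineVector := by
  have := continuous_bump
  unfold lineVector; fun_prop

theorem continuous_lineCoordinate : Continuous lineCoordinate := by
  have := continuous_bump
  have hd : Continuous lineDenominator := by unfold lineDenominator; fun_prop
  unfold lineCoordinate
  exact (hd.inv₀ lineDenominator_ne_zero).smul (by fun_prop)

noncomputable def lineProjection (z : ℂ) : ℂ × ℂ →L[ℂ] ℂ × ℂ :=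
  (lineCoordinate z).smulRight (lineVector z)

theorem continuous_lineProjection : Continuous lineProjection := by
  exact ((ContinuousLinearMap.smulRightL ℂ (ℂ × ℂ) (ℂ × ℂ)).continuous.comp
    continuous_lineCoordinate).clm_apply continuous_lineVector

/-- The projection onto the line at infinity. -/
noncomputable def lineProjectionInfty : ℂ × ℂ →L[ℂ] ℂ × ℂ :=
  (ContinuousLinearMap.fst ℂ ℂ ℂ).smulRight (1, 0)

theorem lineProjection_of_one_le {z : ℂ} (hz : 1 ≤ ‖z‖) :
    lineProjection z = lineProjectionInfty := by
  have hb := bump_of_one_le hz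
  have hd := lineDenominator_ne_zero z
  ext
  all_goals simp [lineProjection, lineProjectionInfty, lineCoordinate, lineVector, hb]
  simp only [lineDenominator, hb, Complex.star_def, map_zero, zero_mul, add_zero] at hd ⊢
  rw [mul_assoc, inv_mul_cancel₀ hd]

end LineProjection

/-- The winding number around `0` of the images of loops, multiplied by `2πi`. -/
theorem exists_winding_hom {X : Type*} [TopologicalSpace X] (f : C(X, {z : ℂ // z ≠ 0})) (b : X) :
    ∃ χ : (FundamentalGroup X b)ᵐᵒᵖ →* Multiplicative ℂ,
      ∀ (γ : Path b b) (ℓ : C(unitInterval, ℂ)), (∀ s, Complex.exp (ℓ s) = f (γ s)) →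
        χ (MulOpposite.op (FundamentalGroup.fromPath (Path.Homotopic.Quotient.mk γ))) =
          Multiplicative.ofAdd (ℓ 1 - ℓ 0) := by
  let cov := Complex.isAddQuotientCoveringMap_exp
  let e : (fun z : ℂ ↦ (⟨_, z.exp_ne_zero⟩ : {z : ℂ // z ≠ 0})) ⁻¹' {f b} :=
    ⟨Complex.log (f b), Subtype.ext (Complex.exp_log (f b).2)⟩
  let Φ := (cov.fundamentalGroupToMulOpposite e).comp (FundamentalGroup.map f b)
  let ι : AddSubgroup.zmultiples (2 * Real.pi * Complex.I) →+ ℂ := AddSubgroup.subtype _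
  let Ψ : FundamentalGroup X b →* Multiplicative ℂ :=
    ((AddMonoidHom.toMultiplicative ι).comp MulOpposite.opMulEquiv.symm.toMonoidHom).comp Φ
  refine ⟨Ψ.fromOpposite (fun _ _ => Commute.all _ _), fun γ ℓ hℓ => ?_⟩
  have h1 := cov.unop_fundamentalGroupToMulOpposite_smul (e := e)
    (γ := FundamentalGroup.map f b (FundamentalGroup.fromPath (Path.Homotopic.Quotient.mk γ)))
  -- The given logarithm is shifted to start at the chosen point e of the fibre, where the deck
  -- transformation is read off.
  have hexp : ∀ s, Complex.exp (ℓ s - ℓ 0 + Complex.log (f b)) = f (γ s) := by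
    intro s
    rw [Complex.exp_add, Complex.exp_sub, hℓ, hℓ, Complex.exp_log (f b).2, γ.source,
      div_mul_cancel₀ _ (f b).2]
  let e' : (fun z : ℂ ↦ (⟨_, z.exp_ne_zero⟩ : {z : ℂ // z ≠ 0})) ⁻¹' {f b} :=
    ⟨ℓ 1 - ℓ 0 + Complex.log (f b), Subtype.ext ((hexp 1).trans (by rw [γ.target]))⟩
  let Γ : Path e.1 e'.1 :=
    { toFun := fun s => ℓ s - ℓ 0 + Complex.log (f b)
      continuous_toFun := by fun_prop
      source' := by simp [e]
      target' := by simp [e'] }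
  have h2 := cov.isCoveringMap.monodromy_eq_of_map_eq (ex := e) (ey := e')
    (γ := Path.Homotopic.Quotient.mk (γ.map f.continuous)) (Path.Homotopic.Quotient.mk Γ) (by
      have hpath : Γ.map cov.isCoveringMap.continuous =
          (γ.map f.continuous).cast e.2 e'.2 := by
        ext s
        exact hexp s
      exact congrArg Path.Homotopic.Quotient.mk hpath)
  have h3 := h1.trans (congrArg Subtype.val h2)
  change Multiplicative.ofAdd (((Φ _).unop.toAdd : ℂ)) = _
  congr 1
  exact add_right_cancel (b := Complex.log (f b)) h3

namespace OrientedKnot.TubularNeighborhood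

variable {K : OrientedKnot}

/-- A function on the complement which winds around `0` as the meridian winds around `K`. -/
theorem exists_meridional_function (N : K.TubularNeighborhood) :
    ∃ (f : C(K.Complement, {z : ℂ // z ≠ 0})) (κ : C(Circle × ℂ, {z : ℂ // z ≠ 0})),
      ∀ (θ : Circle) (z : ℂ) (hz : z ≠ 0),
        (f ⟨N.toFun (θ, z), N.notMem_carrier θ hz⟩ : ℂ) = κ (θ, z) * z := by
  have he := N.isOpenEmbedding
  let g : Circle × ℂ → (ℂ × ℂ →L[ℂ] ℂ × ℂ) := fun p => lineProjection p.2 - lineProjectionInfty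
  have hg : Continuous g := (continuous_lineProjection.comp continuous_snd).sub continuous_const
  have hgc : HasCompactSupport g := by
    refine HasCompactSupport.intro (K := Set.univ ×ˢ Metric.closedBall 0 1)
      (isCompact_univ.prod (isCompact_closedBall 0 1)) ?_
    rintro ⟨θ, z⟩ hz
    have : 1 ≤ ‖z‖ := by
      by_contra! h
      exact hz ⟨trivial, by simpa using h.le⟩
    simp [g, lineProjection_of_one_le this]
  let P : C(S3, ℂ × ℂ →L[ℂ] ℂ × ℂ) := ⟨fun x => lineProjectionInfty + Function.extend N.toFun g 0 x,
    continuous_const.add (continuous_extend_of_hasCompactSupport he hg hgc)⟩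
  have hPin : ∀ p, P (N.toFun p) = lineProjection p.2 := by
    intro p
    simp [P, g, he.injective.extend_apply]
  have hPout : ∀ x, x ∉ Set.range N.toFun → P x = lineProjectionInfty := by
    intro x hx
    simp only [P, ContinuousMap.coe_mk]
    rw [Function.extend_apply' _ _ _ hx]
    simp
  obtain ⟨v, hv⟩ := exists_section_sphere (E := EuclideanSpace ℝ (Fin 4)) (by simp) P (by
    intro x
    by_cases hx : x ∈ Set.range N.toFun
    · obtain ⟨p, rfl⟩ := hx
      exact ⟨lineVector p.2, lineCoordinate p.2, lineCoordinate_lineVector _, fun v => by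
        rw [hPin]; rfl⟩
    · exact ⟨(1, 0), ContinuousLinearMap.fst ℂ ℂ ℂ, by simp, fun v => by rw [hPout x hx]; rfl⟩)
  have hvin : ∀ p, v (N.toFun p) = lineCoordinate p.2 (v (N.toFun p)) • lineVector p.2 := by
    intro p
    conv_lhs => rw [← (hv (N.toFun p)).2, hPin]
    rfl
  have hκ : ∀ p, lineCoordinate p.2 (v (N.toFun p)) ≠ 0 := by
    intro p h0
    have := hvin p
    rw [h0, zero_smul] at this
    exact (hv _).1 this
  have hvin1 : ∀ p, (v (N.toFun p)).1 = lineCoordinate p.2 (v (N.toFun p)) * p.2 := by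
    intro p
    conv_lhs => rw [hvin p]
    rfl
  -- Inside the tube the first coordinate of the section is a nonzero multiple of z; outside, the
  -- section lies on the line through (1, 0).
  have hv1 : ∀ x : K.Complement, (v x).1 ≠ 0 := by
    intro x
    obtain ⟨x, hxK⟩ := x
    by_cases hx : x ∈ Set.range N.toFun
    · obtain ⟨⟨θ, z⟩, rfl⟩ := hx
      dsimp only
      rw [hvin1]
      refine mul_ne_zero (hκ _) ?_
      rintro rfl
      exact hxK ⟨θ, (N.core θ).symm⟩
    · intro h0
      have h1 := (hv x).2
      rw [hPout x hx] at h1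
      refine (hv x).1 (h1.symm.trans ?_)
      simp [lineProjectionInfty, show (v x).1 = 0 from h0]
  refine ⟨⟨fun x => ⟨(v x).1, hv1 x⟩, Continuous.subtype_mk (by fun_prop) _⟩,
    ⟨fun p => ⟨lineCoordinate p.2 (v (N.toFun p)), hκ p⟩, ?_⟩, ?_⟩
  · refine Continuous.subtype_mk ?_ _
    exact (continuous_lineCoordinate.comp continuous_snd).clm_apply
      (v.continuous.comp he.continuous)
  · intro θ z hz
    exact hvin1 (θ, z)

/-- The total linking number with the knot, as a homomorphism on the knot group. -/
theorem exists_linking_hom (N : K.TubularNeighborhood) :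
    ∃ χ : N.KnotGroup →* Multiplicative ℂ,
      χ N.meridian = Multiplicative.ofAdd (2 * Real.pi * Complex.I) := by
  obtain ⟨f, κ, hf⟩ := N.exists_meridional_function
  -- Shrinking the meridian to the core shows that κ has winding number zero along it, so only the
  -- factor z contributes 2πi.
  let H : C(unitInterval × unitInterval, {z : ℂ // z ≠ 0}) :=
    ⟨fun p => κ (1, (p.1 : ℝ) * Circle.exp (2 * Real.pi * p.2)), by fun_prop⟩
  let L := Complex.isCoveringMap_exp.liftHomotopy H (.const _ (Complex.log (κ (1, 0)))) (by
    intro a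
    ext
    simp [H, Complex.exp_log (κ (1, 0)).2])
  have hL : ∀ p, Complex.exp (L p) = H p := fun p =>
    congrArg Subtype.val (congrFun (Complex.isCoveringMap_exp.liftHomotopy_lifts H _ _) p)
  have hL0 : ∀ a, L (0, a) = Complex.log (κ (1, 0)) := fun a =>
    Complex.isCoveringMap_exp.liftHomotopy_zero H _ _ a
  have hL1 : L (1, 1) = L (1, 0) := by
    refine congrFun (?_ : (fun t => L (t, 1)) = fun t => L (t, 0)) 1
    refine Complex.isCoveringMap_exp.eq_of_comp_eq (by fun_prop) (by fun_prop) ?_ 0 ?_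
    · ext t
      change Complex.exp (L (t, 1)) = Complex.exp (L (t, 0))
      rw [hL, hL]
      simp [H]
    · rw [hL0, hL0]
  obtain ⟨χ, hχ⟩ := exists_winding_hom f N.basePoint
  refine ⟨χ, (hχ N.meridianLoop ⟨fun s => L (1, s) + 2 * Real.pi * (s : ℝ) * Complex.I,
    by fun_prop⟩ ?_).trans ?_⟩
  · intro s
    have h := hf 1 (Circle.exp (2 * Real.pi * s)) (Circle.coe_ne_zero _)
    refine Eq.trans ?_ h.symm
    simp only [ContinuousMap.coe_mk]
    rw [Complex.exp_add, hL]
    simp [H, Circle.coe_exp]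
  · simp [hL1]

end OrientedKnot.TubularNeighborhood

/-! ### Holonomies and a van Kampen argument. -/

section DiscretePotential

variable {G : Type*} [Group G]

theorem eq_of_locally_eq_unitInterval {α : Type*} {f : ℝ → α} {δ : ℝ} (hδ : 0 < δ)
    (h : ∀ a ∈ Set.Icc (0 : ℝ) 1, ∀ b ∈ Set.Icc (0 : ℝ) 1, |a - b| < δ → f a = f b) :
    ∀ a ∈ Set.Icc (0 : ℝ) 1, f 0 = f a := by
  obtain ⟨n, hn⟩ := exists_nat_one_div_lt hδ
  intro a ha
  have hn0 : (0 : ℝ) < n + 1 := by positivity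
  have hmem : ∀ k : ℕ, k ≤ n + 1 → a * (k / (n + 1)) ∈ Set.Icc (0 : ℝ) 1 := by
    intro k hk
    have hk' : (k : ℝ) / (n + 1) ≤ 1 := (div_le_one hn0).2 (by exact_mod_cast hk)
    exact ⟨mul_nonneg ha.1 (by positivity), mul_le_one₀ ha.2 (by positivity) hk'⟩
  have key : ∀ k : ℕ, k ≤ n + 1 → f 0 = f (a * (k / (n + 1))) := by
    intro k
    induction k with
    | zero => simp
    | succ k ih =>
      intro hk
      rw [ih (by omega)]
      refine h _ (hmem k (by omega)) _ (hmem _ hk) (lt_of_le_of_lt ?_ hn)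
      rw [← mul_sub, ← sub_div, abs_mul, abs_div, abs_of_pos hn0, abs_of_nonneg ha.1]
      push_cast
      simp only [sub_add_cancel_left, abs_neg, abs_one]
      exact mul_le_of_le_one_left (by positivity) ha.2
  have := key (n + 1) le_rfl
  push_cast at this
  rwa [div_self hn0.ne', mul_one] at this

/-- A locally defined transport with trivial holonomy around small triangles in a bounded convex
set comes from a potential. -/
theorem exists_potential {E : Type*} [NormedAddCommGroup E] [NormedSpace ℝ E] {C : Set E}
    (hC : Convex ℝ C) (h0 : 0 ∈ C) (hb : Bornology.IsBounded C) {T : E → E → G} {δ : ℝ}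
    (hδ : 0 < δ)
    (hT : ∀ p ∈ C, ∀ q ∈ C, ∀ r ∈ C, dist p q < δ → dist p r < δ → T p q * T q r = T p r) :
    ∃ φ : E → G, ∀ p ∈ C, ∀ q ∈ C, dist p q < δ / 2 → T p q = (φ p)⁻¹ * φ q := by
  obtain ⟨R, hR⟩ := hb.exists_norm_le
  obtain ⟨n, hn⟩ := exists_nat_gt (2 * R / δ)
  have hR0 : 0 ≤ R := (norm_nonneg _).trans (hR 0 h0)
  have hn0 : (0 : ℝ) < n := lt_of_le_of_lt (by positivity) hn
  have hRn : R / n < δ / 2 := by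
    rw [div_lt_iff₀ hδ] at hn
    rw [div_lt_iff₀ hn0]
    linarith
  let s : ℕ → E → E := fun k p => ((k : ℝ) / n) • p
  have hs0 : ∀ p, s 0 p = 0 := fun p => by simp [s]
  have hsn : ∀ p, s n p = p := fun p => by simp [s, div_self hn0.ne']
  have hsC : ∀ k ≤ n, ∀ p ∈ C, s k p ∈ C := by
    intro k hk p hp
    exact hC.smul_mem_of_zero_mem h0 hp
      ⟨by positivity, (div_le_one hn0).2 (by exact_mod_cast hk)⟩
  have hstep : ∀ k, ∀ p ∈ C, dist (s k p) (s (k + 1) p) < δ / 2 := by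
    intro k p hp
    rw [dist_eq_norm, ← sub_smul, ← sub_div, norm_smul]
    push_cast
    rw [sub_add_cancel_left, norm_div, norm_neg, norm_one, Real.norm_of_nonneg hn0.le,
      one_div_mul_eq_div]
    exact lt_of_le_of_lt (by gcongr; exact hR p hp) hRn
  have hside : ∀ k ≤ n, ∀ p q, dist p q < δ / 2 → dist (s k p) (s k q) < δ / 2 := by
    intro k hk p q hpq
    rw [dist_smul₀, Real.norm_of_nonneg (by positivity)]
    refine lt_of_le_of_lt (mul_le_of_le_one_left dist_nonneg ?_) hpq
    exact (div_le_one hn0).2 (by exact_mod_cast hk)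
  -- The potential at p is the product of T along the segment from 0 to p cut into n steps.
  -- Neighbouring segments are compared through two small triangles per step.
  let Φ : ℕ → E → G := fun k => Nat.rec (fun _ => 1) (fun k v p => v p * T (s k p) (s (k + 1) p)) k
  have hΦ : ∀ k p, Φ (k + 1) p = Φ k p * T (s k p) (s (k + 1) p) := fun _ _ => rfl
  have key : ∀ p ∈ C, ∀ q ∈ C, dist p q < δ / 2 → ∀ k ≤ n,
      Φ k p * T (s k p) (s k q) = Φ k q := by
    intro p hp q hq hpq k
    induction k with
    | zero =>
      intro _
      have h1 : T 0 0 = 1 := by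
        have := hT 0 h0 0 h0 0 h0 (by simpa using hδ) (by simpa using hδ)
        simpa using this
      rw [hs0, hs0, h1]
      exact mul_one 1
    | succ k ih =>
      intro hk
      have hk' : k ≤ n := by omega
      have hd : dist (s k p) (s (k + 1) q) < δ := by
        have h1 := hside k hk' p q hpq
        have h2 := hstep k q hq
        linarith [dist_triangle (s k p) (s k q) (s (k + 1) q)]
      have hlt : ∀ {x : ℝ}, x < δ / 2 → x < δ := fun h => by linarith
      rw [hΦ, hΦ, mul_assoc,
        hT _ (hsC k hk' p hp) _ (hsC _ hk p hp) _ (hsC _ hk q hq) (hlt (hstep k p hp)) hd,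
        ← hT _ (hsC k hk' p hp) _ (hsC k hk' q hq) _ (hsC _ hk q hq)
          (hlt (hside k hk' p q hpq)) hd, ← mul_assoc, ih hk']
  refine ⟨Φ n, fun p hp q hq hpq => ?_⟩
  have := key p hp q hq hpq n le_rfl
  rw [hsn, hsn] at this
  rw [← this, inv_mul_cancel_left]

end DiscretePotential

open unitInterval

/-- A functor from the fundamental groupoid of `X` to the group `G`. -/
structure Holonomy (X : Type*) [TopologicalSpace X] (G : Type*) [Group G] where
  toFun : ∀ {x y : X}, Path.Homotopic.Quotient x y → G
  map_trans : ∀ {x y z : X} (p : Path.Homotopic.Quotient x y) (q : Path.Homotopic.Quotient y z),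
    toFun (p.trans q) = toFun p * toFun q

namespace Holonomy

variable {X Y G : Type*} [TopologicalSpace X] [TopologicalSpace Y] [Group G]

/-- The holonomy along a path. -/
def along (F : Holonomy X G) {x y : X} (p : Path x y) : G := F.toFun (.mk p)

theorem along_trans (F : Holonomy X G) {x y z : X} (p : Path x y) (q : Path y z) :
    F.along (p.trans q) = F.along p * F.along q := by
  rw [along, Path.Homotopic.Quotient.mk_trans, F.map_trans, along, along]

theorem along_congr (F : Holonomy X G) {x y x' y' : X} (p : Path x y) (q : Path x' y')
    (h : ∀ t, p t = q t) : F.along p = F.along q := by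
  obtain rfl : x = x' := by rw [← p.source, h, q.source]
  obtain rfl : y = y' := by rw [← p.target, h, q.target]
  obtain rfl : p = q := Path.ext (funext h)
  rfl

theorem along_eq_of_homotopic (F : Holonomy X G) {x y : X} {p q : Path x y}
    (h : p.Homotopic q) : F.along p = F.along q := by
  rw [along, along, Path.Homotopic.Quotient.eq.2 h]

theorem along_refl (F : Holonomy X G) (x : X) : F.along (Path.refl x) = 1 := by
  have h := F.along_trans (Path.refl x) (Path.refl x)
  rw [F.along_congr ((Path.refl x).trans (Path.refl x)) (Path.refl x) (by simp)] at h
  simpa using h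

/-- The holonomy along a parametrised curve. -/
def onMap (F : Holonomy X G) (γ : C(I, X)) : G := F.along ⟨γ, rfl, rfl⟩

theorem onMap_eq_along (F : Holonomy X G) {x y : X} (p : Path x y) (γ : C(I, X))
    (h : ∀ t, γ t = p t) : F.onMap γ = F.along p := F.along_congr _ _ h

/-- The pullback of a holonomy along a continuous map. -/
def comap (F : Holonomy X G) (f : C(Y, X)) : Holonomy Y G where
  toFun p := F.toFun (p.map f)
  map_trans p q := by
    induction p, q using Path.Homotopic.Quotient.ind₂ with
    | mk p q =>
      rw [← F.map_trans, ← Path.Homotopic.Quotient.mk_trans, ← Path.Homotopic.Quotient.mk_map,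
        ← Path.Homotopic.Quotient.mk_map, ← Path.Homotopic.Quotient.mk_map,
        ← Path.Homotopic.Quotient.mk_trans, Path.map_trans]

theorem comap_along (F : Holonomy X G) (f : C(Y, X)) {x y : Y} (p : Path x y) :
    (F.comap f).along p = F.along (p.map f.continuous) := rfl

theorem along_eq_of_simplyConnected [SimplyConnectedSpace X] (F : Holonomy X G) {x y : X}
    (p q : Path x y) : F.along p = F.along q :=
  F.along_eq_of_homotopic (SimplyConnectedSpace.paths_homotopic p q)

/-- Changing the trivialisations over the points. -/
def gauge (F : Holonomy X G) (g : X → G) : Holonomy X G where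
  toFun {x y} p := g x * F.toFun p * (g y)⁻¹
  map_trans p q := by rw [F.map_trans]; group

theorem gauge_along (F : Holonomy X G) (g : X → G) {x y : X} (p : Path x y) :
    (F.gauge g).along p = g x * F.along p * (g y)⁻¹ := rfl

open Classical in
/-- A representation of the fundamental group, extended to the fundamental groupoid: trivially
outside of the path component of the base point. -/
theorem exists_of_hom {b : X} (ρ : (FundamentalGroup X b)ᵐᵒᵖ →* G) :
    ∃ (F : Holonomy X G) (g : G), ∀ γ : Path b b,
      ρ (MulOpposite.op (FundamentalGroup.fromPath (Path.Homotopic.Quotient.mk γ))) =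
        g * F.along γ * g⁻¹ := by
  let c : ∀ x, Joined b x → Path.Homotopic.Quotient b x := fun x h => .mk h.somePath
  let R : Path.Homotopic.Quotient b b → G := fun p => ρ (MulOpposite.op (FundamentalGroup.fromPath p))
  have hR : ∀ p q, R (p.trans q) = R p * R q := fun p q => by
    rw [← map_mul, ← MulOpposite.op_mul]
    rfl
  have hRs : ∀ p, R p.symm = (R p)⁻¹ := fun p => by
    rw [eq_inv_iff_mul_eq_one, ← hR, Path.Homotopic.Quotient.symm_trans]
    exact map_one ρ
  have hj : ∀ {x y : X}, Path.Homotopic.Quotient x y → Joined x y := fun p => by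
    induction p using Path.Homotopic.Quotient.ind with
    | mk p => exact ⟨p⟩
  let F : Holonomy X G :=
    { toFun := fun {x y} p => if h : Joined b x then
        R ((c x h).trans (p.trans (c y (h.trans (hj p))).symm)) else 1
      map_trans := fun {x y z} p q => by
        by_cases h : Joined b x
        · have h' : Joined b y := h.trans (hj p)
          rw [dif_pos h, dif_pos h, dif_pos h', ← hR]
          congr 1
          simp only [Path.Homotopic.Quotient.trans_assoc]
          congr 2
          rw [← Path.Homotopic.Quotient.trans_assoc (c y h').symm,
            Path.Homotopic.Quotient.symm_trans, Path.Homotopic.Quotient.refl_trans]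
        · have h' : ¬ Joined b y := fun h' => h (h'.trans (hj p).symm)
          rw [dif_neg h, dif_neg h, dif_neg h', one_mul] }
  -- The path chosen from b to itself need not be constant, hence the conjugation.
  refine ⟨F, (R (c b (Joined.refl b)))⁻¹, fun γ => ?_⟩
  have : F.along γ = R ((c b (Joined.refl b)).trans ((Path.Homotopic.Quotient.mk γ).trans
      (c b (Joined.refl b)).symm)) := dif_pos (Joined.refl b)
  rw [this, hR, hR, hRs]
  change R (.mk γ) = _
  group

end Holonomy

section LinePath

variable {E : Type*} [NormedAddCommGroup E] [NormedSpace ℝ E]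

/-- The straight line from `p` to `q`. -/
noncomputable def lineCurve (p q : E) : C(I, E) :=
  ⟨fun t => AffineMap.lineMap p q (t : ℝ), by
    exact AffineMap.lineMap_continuous.comp continuous_subtype_val⟩

theorem lineCurve_apply (p q : E) (t : I) :
    lineCurve p q t = AffineMap.lineMap p q (t : ℝ) := rfl

theorem lineCurve_mem {B : Set E} (hB : Convex ℝ B) {p q : E} (hp : p ∈ B) (hq : q ∈ B) (t : I) :
    lineCurve p q t ∈ B :=
  hB.lineMap_mem hp hq t.2

variable {X G : Type*} [TopologicalSpace X] [Group G]

/-- On a convex set mapped to `W`, holonomies along straight lines multiply. -/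
theorem Holonomy.onMap_line_mul {W : Set X} (F : Holonomy W G) (H : C(E, X)) {B : Set E}
    (hB : Convex ℝ B) (hBW : ∀ p ∈ B, H p ∈ W) {p q r : E} (hp : p ∈ B) (hq : q ∈ B) (hr : r ∈ B)
    (c : E → E → C(I, W)) (hc : ∀ x ∈ B, ∀ y ∈ B, ∀ t, (c x y t : X) = H (lineCurve x y t)) :
    F.onMap (c p q) * F.onMap (c q r) = F.onMap (c p r) := by
  have : ContractibleSpace B := hB.contractibleSpace ⟨p, hp⟩
  let k : C(B, W) := ⟨fun x => ⟨H x, hBW x x.2⟩, by fun_prop⟩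
  let line : ∀ x y : B, Path x y := fun x y =>
    { toFun := fun t => ⟨lineCurve (x : E) y t, lineCurve_mem hB x.2 y.2 t⟩
      continuous_toFun := by fun_prop
      source' := by ext; simp [lineCurve_apply]
      target' := by ext; simp [lineCurve_apply] }
  have hk : ∀ x y : B, F.onMap (c x y) = (F.comap k).along (line x y) := by
    intro x y
    rw [Holonomy.comap_along]
    apply F.onMap_eq_along
    intro t
    exact Subtype.ext (hc x x.2 y y.2 t)
  rw [hk ⟨p, hp⟩ ⟨q, hq⟩, hk ⟨q, hq⟩ ⟨r, hr⟩, hk ⟨p, hp⟩ ⟨r, hr⟩, ← Holonomy.along_trans]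
  exact Holonomy.along_eq_of_simplyConnected _ _ _

open Classical in
/-- A van Kampen type statement: if the holonomies on two open sets agree on the intersection,
then the holonomy along a null-homotopic loop is trivial. -/
theorem Holonomy.along_eq_one_of_nullHomotopy {U V : Set X} (hU : IsOpen U) (hV : IsOpen V)
    (hUV : U ∪ V = Set.univ) (FU : Holonomy U G) (FV : Holonomy V G)
    (hcompat : ∀ (c : C(I, U)) (c' : C(I, V)), (∀ t, (c t : X) = c' t) →
      FU.onMap c = FV.onMap c')
    {b : V} (γ : Path b b) (H : C(ℝ × ℝ, X)) (h0 : ∀ s : I, H (s, 0) = γ s)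
    (h1 : ∀ s : I, H (s, 1) = H (0, 1)) (hside : ∀ t : I, H (0, t) = H (1, t)) :
    FV.along γ = 1 := by
  let cod : ∀ (W : Set X) (c : C(I, X)), (∀ t, c t ∈ W) → C(I, W) := fun W c h =>
    ⟨fun t => ⟨c t, h t⟩, by fun_prop⟩
  -- Curves inside V use `FV`, other curves inside U use `FU`, and the rest get the junk value 1. By
  -- compatibility the preference for V does not matter.
  let τ : C(I, X) → G := fun c => if hv : ∀ t, c t ∈ V then FV.onMap (cod V c hv) else
    if hu : ∀ t, c t ∈ U then FU.onMap (cod U c hu) else 1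
  have τV : ∀ c (hv : ∀ t, c t ∈ V), τ c = FV.onMap (cod V c hv) := fun c hv => dif_pos hv
  have τU : ∀ c (hu : ∀ t, c t ∈ U), τ c = FU.onMap (cod U c hu) := by
    intro c hu
    by_cases hv : ∀ t, c t ∈ V
    · rw [τV c hv]
      exact (hcompat _ _ fun t => rfl).symm
    · exact (dif_neg hv).trans (dif_pos hu)
  let T : ℝ × ℝ → ℝ × ℝ → G := fun p q => τ (H.comp (lineCurve p q))
  have hTtri : ∀ (W : Set X) (F : Holonomy W G), (∀ c (hw : ∀ t, c t ∈ W), τ c = F.onMap (cod W c hw)) →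
      ∀ B : Set (ℝ × ℝ), Convex ℝ B → (∀ p ∈ B, H p ∈ W) → ∀ p ∈ B, ∀ q ∈ B, ∀ r ∈ B,
        T p q * T q r = T p r := by
    intro W F hτ B hB hBW p hp q hq r hr
    have hW : ∀ x ∈ B, ∀ y ∈ B, ∀ t, H.comp (lineCurve x y) t ∈ W := fun x hx y hy t =>
      hBW _ (lineCurve_mem hB hx hy t)
    let c : ℝ × ℝ → ℝ × ℝ → C(I, W) := fun x y =>
      if h : ∀ t, H.comp (lineCurve x y) t ∈ W then cod W _ h else
        cod W (.const I (H p)) fun _ => hBW p hp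
    have hc : ∀ x ∈ B, ∀ y ∈ B, ∀ h, c x y = cod W (H.comp (lineCurve x y)) h :=
      fun x hx y hy h => dif_pos h
    have hTc : ∀ x ∈ B, ∀ y ∈ B, T x y = F.onMap (c x y) := by
      intro x hx y hy
      rw [hc x hx y hy (hW x hx y hy)]
      exact hτ _ _
    rw [hTc p hp q hq, hTc q hq r hr, hTc p hp r hr]
    refine F.onMap_line_mul H hB hBW hp hq hr c fun x hx y hy t => ?_
    rw [hc x hx y hy (hW x hx y hy)]
    rfl
  let C : Set (ℝ × ℝ) := Set.Icc 0 1
  have hC : ∀ a ∈ Set.Icc (0 : ℝ) 1, ∀ b ∈ Set.Icc (0 : ℝ) 1, ((a, b) : ℝ × ℝ) ∈ C := fun a ha b hb =>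
    ⟨⟨ha.1, hb.1⟩, ⟨ha.2, hb.2⟩⟩
  have i0 : (0 : ℝ) ∈ Set.Icc (0 : ℝ) 1 := ⟨le_rfl, zero_le_one⟩
  have i1 : (1 : ℝ) ∈ Set.Icc (0 : ℝ) 1 := ⟨zero_le_one, le_rfl⟩
  obtain ⟨δ, hδ, hleb⟩ := lebesgue_number_lemma_of_metric (s := C)
    (c := fun i : Bool => H ⁻¹' (bif i then U else V)) isCompact_Icc
    (fun i => by cases i <;> simp <;> [exact hV.preimage H.continuous; exact hU.preimage H.continuous])
    (fun p _ => by
      have : H p ∈ U ∪ V := hUV ▸ Set.mem_univ _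
      rcases this with h | h
      · exact Set.mem_iUnion.2 ⟨true, h⟩
      · exact Set.mem_iUnion.2 ⟨false, h⟩)
  obtain ⟨φ, hφ⟩ := exists_potential (convex_Icc (0 : ℝ × ℝ) 1) (hC 0 i0 0 i0)
    (Metric.isBounded_Icc _ _) hδ (T := T) (by
      intro p hp q hq r hr hpq hpr
      obtain ⟨i, hi⟩ := hleb p hp
      have hpB := Metric.mem_ball_self (x := p) hδ
      have hqB : q ∈ Metric.ball p δ := by rwa [Metric.mem_ball, dist_comm]
      have hrB : r ∈ Metric.ball p δ := by rwa [Metric.mem_ball, dist_comm]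
      cases i with
      | true => exact hTtri U FU τU _ (convex_ball p δ) (fun x hx => hi hx) p hpB q hqB r hrB
      | false => exact hTtri V FV τV _ (convex_ball p δ) (fun x hx => hi hx) p hpB q hqB r hrB)
  have hδ2 : 0 < δ / 2 := by positivity
  have hdist1 : ∀ a b c : ℝ, dist (a, c) (b, c) = |a - b| := fun a b c => by
    rw [Prod.dist_eq]; simp [Real.dist_eq]
  have hdist2 : ∀ a b c : ℝ, dist (c, a) (c, b) = |a - b| := fun a b c => by
    rw [Prod.dist_eq]; simp [Real.dist_eq]
  have hline1 : ∀ (a b c : ℝ) (t : I),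
      lineCurve ((a, c) : ℝ × ℝ) (b, c) t = (AffineMap.lineMap a b (t : ℝ), c) := by
    intro a b c t
    simp [lineCurve_apply, AffineMap.lineMap_apply]
  have hline2 : ∀ (a b c : ℝ) (t : I),
      lineCurve ((c, a) : ℝ × ℝ) (c, b) t = (c, AffineMap.lineMap a b (t : ℝ)) := by
    intro a b c t
    simp [lineCurve_apply, AffineMap.lineMap_apply]
  have hlmem : ∀ a ∈ Set.Icc (0 : ℝ) 1, ∀ b ∈ Set.Icc (0 : ℝ) 1, ∀ t : I,
      AffineMap.lineMap a b (t : ℝ) ∈ Set.Icc (0 : ℝ) 1 := fun a ha b hb t =>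
    (convex_Icc (0 : ℝ) 1).lineMap_mem ha hb t.2
  -- The whole bottom edge maps to V, so the triangle identity holds there without a smallness
  -- condition, and the potential computes the holonomy of γ. The constant top and the matching
  -- sides then show that φ agrees at the two bottom corners.
  have hbot : T (0, 0) (1, 0) = (φ (0, 0))⁻¹ * φ (1, 0) := by
    have htri := hTtri V FV τV (Set.Icc 0 1 ×ˢ {0}) ((convex_Icc 0 1).prod (convex_singleton 0)) (by
      rintro ⟨a, c⟩ ⟨ha, hc⟩
      obtain rfl : c = 0 := hc
      rw [h0 ⟨a, ha⟩]
      exact (γ _).2)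
    have hconst := eq_of_locally_eq_unitInterval hδ2
      (f := fun a => φ (a, 0) * (T (0, 0) (a, 0))⁻¹) (by
        intro a ha b hb hab
        have h2 := hφ (a, 0) (hC a ha 0 i0) (b, 0) (hC b hb 0 i0) (by rwa [hdist1])
        rw [← htri (0, 0) ⟨i0, rfl⟩ (a, 0) ⟨ha, rfl⟩ (b, 0) ⟨hb, rfl⟩, h2]
        group) 1 i1
    have hT00 : T (0, 0) (0, 0) = 1 := by
      have := htri (0, 0) ⟨i0, rfl⟩ (0, 0) ⟨i0, rfl⟩ (0, 0) ⟨i0, rfl⟩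
      simpa using this
    rw [hT00, inv_one, mul_one] at hconst
    rw [hconst]
    group
  have htop : φ (0, 1) = φ (1, 1) := by
    refine eq_of_locally_eq_unitInterval hδ2 (f := fun a => φ (a, 1)) ?_ 1 i1
    intro a ha b hb hab
    have hconst : ∀ x ∈ Set.Icc (0 : ℝ) 1, ∀ y ∈ Set.Icc (0 : ℝ) 1,
        H.comp (lineCurve (x, 1) (y, 1)) = .const I (H (0, 1)) := by
      intro x hx y hy
      ext t
      rw [ContinuousMap.comp_apply, hline1, h1 ⟨_, hlmem x hx y hy t⟩]
      rfl
    have h2 := hφ (a, 1) (hC a ha 1 i1) (b, 1) (hC b hb 1 i1) (by rwa [hdist1])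
    have h3 := hφ (a, 1) (hC a ha 1 i1) (a, 1) (hC a ha 1 i1) (by simpa using hδ2)
    have h4 : T (a, 1) (b, 1) = T (a, 1) (a, 1) := by
      simp only [T]
      rw [hconst a ha b hb, hconst a ha a ha]
    rw [h4, h3, inv_mul_cancel] at h2
    exact (inv_mul_eq_one.1 h2.symm)
  have hsides : φ (1, 0) * (φ (0, 0))⁻¹ = φ (1, 1) * (φ (0, 1))⁻¹ := by
    refine eq_of_locally_eq_unitInterval hδ2 (f := fun a => φ (1, a) * (φ (0, a))⁻¹) ?_ 1 i1
    intro a ha b hb hab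
    have h2 := hφ (0, a) (hC 0 i0 a ha) (0, b) (hC 0 i0 b hb) (by rwa [hdist2])
    have h3 := hφ (1, a) (hC 1 i1 a ha) (1, b) (hC 1 i1 b hb) (by rwa [hdist2])
    have h4 : T (0, a) (0, b) = T (1, a) (1, b) := by
      simp only [T]
      congr 1
      ext t
      rw [ContinuousMap.comp_apply, ContinuousMap.comp_apply, hline2, hline2]
      exact hside ⟨_, hlmem a ha b hb t⟩
    rw [h2, h3] at h4
    have h5 : φ (0, b) = φ (0, a) * ((φ (1, a))⁻¹ * φ (1, b)) := by
      rw [← h4, mul_inv_cancel_left]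
    rw [h5]
    group
  rw [htop, mul_inv_cancel, mul_inv_eq_one] at hsides
  rw [hsides, inv_mul_cancel] at hbot
  rw [← hbot]
  have hV' : ∀ t, H.comp (lineCurve ((0, 0) : ℝ × ℝ) (1, 0)) t = γ t := by
    intro t
    rw [ContinuousMap.comp_apply, hline1]
    simpa [AffineMap.lineMap_apply] using h0 t
  rw [show T (0, 0) (1, 0) = _ from τV _ fun t => by rw [hV']; exact (γ t).2]
  refine (FV.onMap_eq_along _ _ fun t => Subtype.ext (hV' t)).symm

end LinePath

/-! ### Null-homotopies of loops in spheres. -/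

section NullHomotopy

open Module

variable {E : Type*} [NormedAddCommGroup E] [InnerProductSpace ℝ E]

/-- The radial projection onto the unit sphere, on a family of nonzero vectors. -/
theorem exists_normalize {A : Type*} [TopologicalSpace A] (f : C(A, E)) (hf : ∀ a, f a ≠ 0) :
    ∃ g : C(A, Metric.sphere (0 : E) 1), ∀ a, (g a : E) = ‖f a‖⁻¹ • f a := by
  have hmem : ∀ a, ‖f a‖⁻¹ • f a ∈ Metric.sphere (0 : E) 1 := fun a => by
    rw [mem_sphere_zero_iff_norm, norm_smul, norm_inv, norm_norm,
      inv_mul_cancel₀ (norm_ne_zero_iff.2 (hf a))]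
  exact ⟨⟨fun a => ⟨_, hmem a⟩, Continuous.subtype_mk
    ((f.continuous.norm.inv₀ fun a => norm_ne_zero_iff.2 (hf a)).smul f.continuous) hmem⟩,
    fun _ => rfl⟩

/-- Loops in spheres of dimension at least two are null-homotopic. -/
theorem exists_nullHomotopy_sphere [FiniteDimensional ℝ E] (h : 3 ≤ finrank ℝ E)
    (γ : C(I, Metric.sphere (0 : E) 1)) (hγ : γ 0 = γ 1) :
    ∃ H : C(ℝ × ℝ, Metric.sphere (0 : E) 1), (∀ s : I, H (s, 0) = γ s) ∧
      (∀ s : I, H (s, 1) = H (0, 1)) ∧ ∀ t : I, H (0, t) = H (1, t) := by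
  let pr : C(ℝ, I) := ⟨Set.projIcc 0 1 zero_le_one, continuous_projIcc⟩
  have hpr : ∀ s : I, pr s = s := fun s => Set.projIcc_val zero_le_one s
  have hpr0 : pr 0 = 0 := hpr 0
  have hpr1 : pr 1 = 1 := hpr 1
  let c : ℝ → E := fun s => γ (pr s)
  have hc : Continuous c := by fun_prop
  have hcn : ∀ s, ‖c s‖ = 1 := fun s => norm_eq_of_mem_sphere _
  obtain ⟨p₀, hp₀, hpc₀, -⟩ := hc.exists_contDiff_approx 1 (ε := fun _ => 1 / 2)
    continuous_const (fun _ => by norm_num)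
  -- The affine correction restores the endpoints. It costs at most another 1/2, and the total stays
  -- below 1, the norm of c.
  let p : ℝ → E := fun s => p₀ s + ((1 - s) • (c 0 - p₀ 0) + s • (c 1 - p₀ 1))
  have hp : ContDiff ℝ 1 p := hp₀.add (((contDiff_const.sub contDiff_id).smul contDiff_const).add
    (contDiff_id.smul contDiff_const))
  have hp0 : p 0 = c 0 := by simp [p]
  have hp1 : p 1 = c 1 := by simp [p]
  have hpc : ∀ s : I, ‖p s - c s‖ < 1 := by
    intro s
    have h1 := hpc₀ s
    have h2 := hpc₀ 0
    have h3 := hpc₀ 1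
    rw [dist_eq_norm] at h1
    rw [dist_comm, dist_eq_norm] at h2 h3
    have h4 : ‖(1 - (s : ℝ)) • (c 0 - p₀ 0) + (s : ℝ) • (c 1 - p₀ 1)‖ ≤ 1 / 2 := by
      refine (norm_add_le _ _).trans ?_
      rw [norm_smul, norm_smul, Real.norm_of_nonneg (sub_nonneg.2 s.2.2),
        Real.norm_of_nonneg s.2.1]
      have := s.2.1
      have := s.2.2
      nlinarith
    have h5 : p s - c s =
        (p₀ s - c s) + ((1 - (s : ℝ)) • (c 0 - p₀ 0) + (s : ℝ) • (c 1 - p₀ 1)) := by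
      simp only [p]; abel
    rw [h5]
    exact (norm_add_le _ _).trans_lt (by linarith)
  -- A C¹ image of a plane has dense complement in dimension at least 3, so some w lies off every
  -- line through 0 and a point of p.
  let cone : ℝ × ℝ → E := fun x => x.1 • p x.2
  have hcone : ContDiff ℝ 1 cone := contDiff_fst.smul (hp.comp contDiff_snd)
  have hdense : Dense (Set.range cone)ᶜ :=
    hcone.dense_compl_range_of_finrank_lt_finrank (by simp; omega)
  obtain ⟨w, hw⟩ := hdense.nonempty
  have hw' : ∀ (a s : ℝ), a • p s ≠ w := fun a s hs => hw ⟨(a, s), hs⟩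
  have hw0 : w ≠ 0 := by
    have := hw' 0 0
    rwa [zero_smul, ne_comm] at this
  -- Up to time 1/2 the loop moves linearly from c to p, avoiding 0 since ‖p - c‖ < 1. Afterwards p
  -- is contracted to w, avoiding 0 since w is no real multiple of a value of p.
  let α : ℝ → ℝ := fun t => min (max (2 * t) 0) 1
  let β : ℝ → ℝ := fun t => min (max (2 * t - 1) 0) 1
  let f : C(ℝ × ℝ, E) := ⟨fun x => (1 - β x.2) • ((1 - α x.2) • c x.1 + α x.2 • p (pr x.1)) +
    β x.2 • w, by fun_prop⟩
  have hf : ∀ x, f x ≠ 0 := by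
    rintro ⟨s, t⟩ h0
    change (1 - β t) • ((1 - α t) • c s + α t • p (pr s)) + β t • w = 0 at h0
    by_cases hβ : β t = 0
    · rw [hβ, sub_zero, one_smul, zero_smul, add_zero] at h0
      have hcs : c s = c (pr s) := by simp only [c, hpr]
      have h1 : c s = -(α t • (p (pr s) - c (pr s))) := by
        rw [← hcs, ← sub_eq_zero, ← h0, sub_smul, smul_sub, one_smul]
        abel
      have h2 := hcn s
      have hα : |α t| ≤ 1 := abs_le.2
        ⟨by linarith [le_min (le_max_right (2 * t) 0) zero_le_one], min_le_right _ _⟩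
      rw [h1, norm_neg, norm_smul, Real.norm_eq_abs] at h2
      have h3 := mul_le_of_le_one_left (norm_nonneg (p (pr s) - c (pr s))) hα
      linarith [hpc (pr s)]
    · have ht : 0 < 2 * t - 1 := by
        by_contra! ht
        exact hβ (by simp [β, ht])
      have hα : α t = 1 := min_eq_right (le_max_of_le_left (by linarith))
      rw [hα, sub_self, zero_smul, zero_add, one_smul, add_eq_zero_iff_eq_neg] at h0
      apply hw' (-((β t)⁻¹ * (1 - β t))) (pr s)
      rw [neg_smul, mul_smul, h0, smul_neg, neg_neg, inv_smul_smul₀ hβ]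
  obtain ⟨H, hH⟩ := exists_normalize f hf
  have hHeq : ∀ x y, f x = f y → H x = H y := fun x y hxy => by
    ext1
    rw [hH, hH, hxy]
  refine ⟨H, fun s => ?_, fun s => hHeq _ _ ?_, fun t => hHeq _ _ ?_⟩
  · ext1
    have : f (s, 0) = c s := by simp [f, α, β]
    rw [hH, this, hcn, inv_one, one_smul]
    simp [c, hpr]
  · norm_num [f, α, β]
  · have h01 : c 0 = c 1 := by simp only [c, hpr0, hpr1, hγ]
    have hp01 : p 0 = p 1 := by rw [hp0, hp1, h01]
    simp [f, h01, hp01, hpr0, hpr1]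

end NullHomotopy

/-! ### The punctured tube and the normal closure of the meridian. -/

namespace OrientedKnot.TubularNeighborhood

variable {K : OrientedKnot} (N : K.TubularNeighborhood)

/-- The universal cover of the punctured tube around the knot, mapped to the complement. -/
noncomputable def tubeCover : C(ℝ × ℂ, K.Complement) :=
  ⟨fun y => ⟨N.toFun (Circle.exp y.1, Complex.exp y.2),
    N.notMem_carrier _ (Complex.exp_ne_zero _)⟩,
    Continuous.subtype_mk (N.isOpenEmbedding.continuous.comp (by fun_prop)) _⟩

theorem tubeCover_add (j k : ℤ) (y : ℝ × ℂ) :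
    N.tubeCover ((j * (2 * Real.pi), k * (2 * Real.pi * Complex.I)) + y) = N.tubeCover y := by
  apply Subtype.ext
  change N.toFun (Circle.exp (j * (2 * Real.pi) + y.1),
    Complex.exp (k * (2 * Real.pi * Complex.I) + y.2)) = _
  rw [Circle.exp_add, Complex.exp_add, Complex.exp_int_mul_two_pi_mul_I, Circle.exp_int_mul_two_pi,
    one_mul, one_mul]
  rfl

variable {G : Type*} [Group G] (F : Holonomy K.Complement G)

/-- The holonomy from the base point of the universal cover of the punctured tube. -/
noncomputable def tubeHolonomy (y : ℝ × ℂ) : G :=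
  (F.comap N.tubeCover).along (PathConnectedSpace.somePath 0 y)

theorem along_map_tubeCover {y y' : ℝ × ℂ} (p : Path y y') :
    F.along (p.map N.tubeCover.continuous) = (N.tubeHolonomy F y)⁻¹ * N.tubeHolonomy F y' := by
  rw [eq_inv_mul_iff_mul_eq]
  change N.tubeHolonomy F y * (F.comap N.tubeCover).along p = _
  rw [tubeHolonomy, ← Holonomy.along_trans]
  exact Holonomy.along_eq_of_simplyConnected _ _ _

theorem tubeHolonomy_eq_along {y : ℝ × ℂ} (p : Path 0 y) :
    N.tubeHolonomy F y = (F.comap N.tubeCover).along p :=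
  Holonomy.along_eq_of_simplyConnected _ _ _

/-- The translate of a path by a period has the same image in the complement, and the cover is
simply connected. -/
theorem tubeHolonomy_add (j k : ℤ) (y : ℝ × ℂ) :
    N.tubeHolonomy F ((j * (2 * Real.pi), k * (2 * Real.pi * Complex.I)) + y) =
      N.tubeHolonomy F (j * (2 * Real.pi), k * (2 * Real.pi * Complex.I)) * N.tubeHolonomy F y := by
  set L : ℝ × ℂ := (j * (2 * Real.pi), k * (2 * Real.pi * Complex.I)) with hL
  let q : Path L (L + y) :=
    { toFun := fun t => L + PathConnectedSpace.somePath 0 y t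
      continuous_toFun := by fun_prop
      source' := by simp
      target' := by simp }
  have h1 := N.along_map_tubeCover F q
  have h2 : F.along (q.map N.tubeCover.continuous) = N.tubeHolonomy F y := by
    apply F.along_congr
    intro t
    exact N.tubeCover_add j k _
  rw [← h2, h1, mul_inv_cancel_left]

theorem along_meridianLoop :
    F.along N.meridianLoop = N.tubeHolonomy F (0, 2 * Real.pi * Complex.I) := by
  let p : Path (0 : ℝ × ℂ) (0, 2 * Real.pi * Complex.I) :=
    { toFun := fun t => (0, 2 * Real.pi * (t : ℝ) * Complex.I)
      continuous_toFun := by fun_prop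
      source' := by simp
      target' := by simp }
  rw [N.tubeHolonomy_eq_along F p]
  apply F.along_congr
  intro t
  apply Subtype.ext
  change N.toFun (1, (Circle.exp (2 * Real.pi * t) : ℂ)) =
    N.toFun (Circle.exp 0, Complex.exp (2 * Real.pi * (t : ℝ) * Complex.I))
  rw [Circle.coe_exp, Circle.exp_zero]
  push_cast
  rfl

theorem along_longitudeLoop :
    F.along N.longitudeLoop = N.tubeHolonomy F (2 * Real.pi, 0) := by
  let p : Path (0 : ℝ × ℂ) (2 * Real.pi, 0) :=
    { toFun := fun t => (2 * Real.pi * (t : ℝ), 0)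
      continuous_toFun := by fun_prop
      source' := by simp
      target' := by simp }
  rw [N.tubeHolonomy_eq_along F p]
  apply F.along_congr
  intro t
  apply Subtype.ext
  change N.toFun (Circle.exp (2 * Real.pi * t), ((1 : Circle) : ℂ)) =
    N.toFun (Circle.exp (2 * Real.pi * t), Complex.exp 0)
  rw [Complex.exp_zero]
  rfl

/-- For the tautological representation, translating by the two periods in either order computes the
same holonomy, at their sum. -/
theorem meridian_mul_longitude : N.meridian * N.longitude = N.longitude * N.meridian := by
  obtain ⟨F, g, hF⟩ := Holonomy.exists_of_hom (MonoidHom.id N.KnotGroup)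
  have hm : N.meridian = g * N.tubeHolonomy F (0, 2 * Real.pi * Complex.I) * g⁻¹ := by
    rw [← along_meridianLoop]; exact hF _
  have hl : N.longitude = g * N.tubeHolonomy F (2 * Real.pi, 0) * g⁻¹ := by
    rw [← along_longitudeLoop]; exact hF _
  have h1 := N.tubeHolonomy_add F 0 1 (2 * Real.pi, 0)
  have h2 := N.tubeHolonomy_add F 1 0 (0, 2 * Real.pi * Complex.I)
  simp only [Int.cast_zero, Int.cast_one, zero_mul, one_mul, Prod.mk_add_mk, zero_add,
    add_zero] at h1 h2
  have h3 := h1.symm.trans h2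
  rw [hm, hl]
  calc _ = g * (N.tubeHolonomy F (0, 2 * Real.pi * Complex.I) *
        N.tubeHolonomy F (2 * Real.pi, 0)) * g⁻¹ := by group
    _ = _ := by rw [h3]; group

theorem isClosed_carrier (N : K.TubularNeighborhood) : IsClosed K.carrier := by
  have : K.carrier = Set.range fun θ : Circle => N.toFun (θ, 0) :=
    congrArg Set.range (funext fun θ => (N.core θ).symm)
  rw [this]
  exact (isCompact_range (N.isOpenEmbedding.continuous.comp (by fun_prop))).isClosed

theorem tubeHolonomy_int_mul (hm : F.along N.meridianLoop = 1) (k : ℤ) :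
    N.tubeHolonomy F (0, k * (2 * Real.pi * Complex.I)) = 1 := by
  rw [along_meridianLoop] at hm
  have hstep : ∀ k : ℤ, N.tubeHolonomy F (0, ((k + 1 : ℤ) : ℂ) * (2 * Real.pi * Complex.I)) =
      N.tubeHolonomy F (0, k * (2 * Real.pi * Complex.I)) := by
    intro k
    have := N.tubeHolonomy_add F 0 1 (0, k * (2 * Real.pi * Complex.I))
    simp only [Int.cast_zero, Int.cast_one, zero_mul, one_mul, Prod.mk_add_mk, add_zero, hm] at this
    rw [← this]
    push_cast
    congr 2
    ring
  induction k using Int.induction_on with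
  | zero =>
    have := N.tubeHolonomy_add F 0 0 (0, 0)
    simpa only [Int.cast_zero, zero_mul, Prod.mk_add_mk, add_zero, left_eq_mul] using this
  | succ k ih => rw [hstep, ih]
  | pred k ih =>
    rw [← hstep]
    simpa using ih

theorem tubeHolonomy_log_exp (hm : F.along N.meridianLoop = 1) (a : ℝ) (w : ℂ) :
    N.tubeHolonomy F (a, Complex.log (Complex.exp w)) = N.tubeHolonomy F (a, w) := by
  obtain ⟨k, hk⟩ := Complex.exp_eq_exp_iff_exists_int.1 (Complex.exp_log (Complex.exp_ne_zero w))
  have := N.tubeHolonomy_add F 0 k (a, w)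
  simp only [Int.cast_zero, zero_mul, Prod.mk_add_mk, zero_add,
    N.tubeHolonomy_int_mul F hm k, one_mul] at this
  rw [hk, add_comm w, this]

open Classical in
/-- Trivialisations over the points of the complement, adapted to the tube. -/
noncomputable def tubeGauge (x : K.Complement) : G :=
  if h : ∃ p, N.toFun p = x then
    N.tubeHolonomy F (Complex.arg h.choose.1, Complex.log h.choose.2) else 1

theorem tubeGauge_apply (x : K.Complement) (p : Circle × ℂ) (hp : N.toFun p = x) :
    N.tubeGauge F x = N.tubeHolonomy F (Complex.arg p.1, Complex.log p.2) := by
  have h : ∃ p, N.toFun p = x := ⟨p, hp⟩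
  have : h.choose = p := N.isOpenEmbedding.injective (h.choose_spec.trans hp.symm)
  rw [tubeGauge, dif_pos h, this]

/-- After the gauge change, the value at (a, w) of gauge times inverse tube holonomy is the holonomy
of a longitudinal period, which does not depend on w. Radial and meridional motion thus become
invisible, and the holonomy extends across the knot. -/
theorem gauge_along_map_tubeCover (hm : F.along N.meridianLoop = 1) {a a' : ℝ} {w w' : ℂ}
    (p : Path ((a, w) : ℝ × ℂ) (a', w')) (q : Path ((a, 0) : ℝ × ℂ) (a', 0)) :
    (F.gauge (N.tubeGauge F)).along (p.map N.tubeCover.continuous) =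
      (F.gauge (N.tubeGauge F)).along (q.map N.tubeCover.continuous) := by
  have key : ∀ (a : ℝ) (w : ℂ), N.tubeGauge F (N.tubeCover (a, w)) * (N.tubeHolonomy F (a, w))⁻¹ =
      N.tubeGauge F (N.tubeCover (a, 0)) * (N.tubeHolonomy F (a, 0))⁻¹ := by
    intro a w
    have hg : ∀ w, N.tubeGauge F (N.tubeCover (a, w)) =
        N.tubeHolonomy F (Complex.arg (Circle.exp a), w) := by
      intro w
      rw [N.tubeGauge_apply F (N.tubeCover (a, w)) (Circle.exp a, Complex.exp w) rfl,
        N.tubeHolonomy_log_exp F hm]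
    obtain ⟨j, hj⟩ := Circle.exp_eq_exp.1 (Circle.exp_arg (Circle.exp a))
    rw [hg, hg, hj]
    have h1 := N.tubeHolonomy_add F j 0 (a, w)
    have h2 := N.tubeHolonomy_add F j 0 (a, 0)
    simp only [Int.cast_zero, zero_mul, Prod.mk_add_mk, zero_add] at h1 h2
    rw [add_comm a, h1, h2]
    group
  have hform : ∀ {y y' : ℝ × ℂ} (p : Path y y'),
      (F.gauge (N.tubeGauge F)).along (p.map N.tubeCover.continuous) =
        (N.tubeGauge F (N.tubeCover y) * (N.tubeHolonomy F y)⁻¹) *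
          (N.tubeGauge F (N.tubeCover y') * (N.tubeHolonomy F y')⁻¹)⁻¹ := by
    intro y y' p
    rw [Holonomy.gauge_along, along_map_tubeCover]
    group
  rw [hform, hform, key a w, key a' w']

/-- A holonomy which is trivial on the meridian is trivial on all loops of the complement. -/
theorem along_eq_one (hm : F.along N.meridianLoop = 1) {b : K.Complement} (γ : Path b b) :
    F.along γ = 1 := by
  obtain ⟨H, hH0, hH1, hHside⟩ := exists_nullHomotopy_sphere (E := EuclideanSpace ℝ (Fin 4))
    (by simp) ⟨fun t => (γ t : S3), by fun_prop⟩ (by simp)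
  let FV : Holonomy K.Complement G := F.gauge (N.tubeGauge F)
  let e : (Circle × ℂ) ≃ₜ Set.range N.toFun := N.isOpenEmbedding.isEmbedding.toHomeomorph
  let parallel : C(Circle, K.Complement) :=
    ⟨fun θ => N.torus (θ, 1), N.continuous_torus.comp (by fun_prop)⟩
  -- On the full tube, curves are first pushed onto the parallel z = 1, so that they may cross the
  -- knot.
  let FU : Holonomy (Set.range N.toFun) G :=
    FV.comap ⟨fun x => parallel (e.symm x).1, by fun_prop⟩
  have hUV : Set.range N.toFun ∪ {x | x ∉ K.carrier} = Set.univ := by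
    refine Set.eq_univ_of_forall fun x => ?_
    by_cases hx : x ∈ K.carrier
    · obtain ⟨θ, rfl⟩ := hx
      exact Or.inl ⟨(θ, 0), N.core θ⟩
    · exact Or.inr hx
  have hcompat : ∀ (c : C(I, Set.range N.toFun)) (c' : C(I, {x : S3 | x ∉ K.carrier})),
      (∀ t, (c t : S3) = c' t) → FU.onMap c = Holonomy.onMap (X := {x : S3 | x ∉ K.carrier}) FV c' := by
    intro c c' hcc
    have hz : ∀ t, (e.symm (c t)).2 ≠ 0 := by
      intro t ht
      apply (c' t).2
      rw [← hcc t, ← e.apply_symm_apply (c t)]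
      exact ⟨(e.symm (c t)).1, by rw [← N.core, ← ht]; rfl⟩
    let θ : C(I, Circle) := ⟨fun t => (e.symm (c t)).1, by fun_prop⟩
    let z : C(I, {z : ℂ // z ≠ 0}) := ⟨fun t => ⟨(e.symm (c t)).2, hz t⟩, by fun_prop⟩
    obtain ⟨α, hα, -⟩ := Circle.isCoveringMap_exp.exists_path_lifts θ (Complex.arg (θ 0))
      (Circle.exp_arg _).symm
    obtain ⟨w, hw, -⟩ := Complex.isCoveringMap_exp.exists_path_lifts z (Complex.log (z 0))
      (Subtype.ext (Complex.exp_log (z 0).2).symm)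
    let p : Path ((α 0, w 0) : ℝ × ℂ) (α 1, w 1) := ⟨⟨fun t => (α t, w t), by fun_prop⟩, rfl, rfl⟩
    let q : Path ((α 0, 0) : ℝ × ℂ) (α 1, 0) := ⟨⟨fun t => (α t, 0), by fun_prop⟩, rfl, rfl⟩
    have hα' : ∀ t, Circle.exp (α t) = (e.symm (c t)).1 := fun t => congrFun hα t
    have hw' : ∀ t, Complex.exp (w t) = (e.symm (c t)).2 := fun t =>
      congrArg Subtype.val (congrFun hw t)
    have hp : Holonomy.onMap (X := {x : S3 | x ∉ K.carrier}) FV c' =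
        FV.along (p.map N.tubeCover.continuous) := by
      refine FV.along_congr _ _ fun t => Subtype.ext ?_
      change (c' t : S3) = N.toFun (Circle.exp (α t), Complex.exp (w t))
      rw [hα', hw', ← hcc]
      exact congrArg Subtype.val (e.apply_symm_apply (c t)).symm
    have hq : FU.onMap c = FV.along (q.map N.tubeCover.continuous) := by
      refine FV.along_congr _ _ fun t => Subtype.ext ?_
      change N.toFun ((e.symm (c t)).1, ((1 : Circle) : ℂ)) =
        N.toFun (Circle.exp (α t), Complex.exp 0)
      rw [hα', Complex.exp_zero]
      rfl
    rw [hp, hq]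
    exact (N.gauge_along_map_tubeCover F hm p q).symm
  have h := Holonomy.along_eq_one_of_nullHomotopy N.isOpenEmbedding.isOpen_range
    N.isClosed_carrier.isOpen_compl hUV FU FV hcompat γ H hH0 hH1 hHside
  have h' : N.tubeGauge F b * F.along γ * (N.tubeGauge F b)⁻¹ = 1 := h
  rwa [mul_inv_eq_one, mul_eq_left] at h'

/-- Apply `along_eq_one` to the quotient of the knot group by the normal closure of the meridian. -/
theorem longitude_mem_normalClosure : N.longitude ∈ Subgroup.normalClosure {N.meridian} := by
  let ρ := QuotientGroup.mk' (Subgroup.normalClosure {N.meridian})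
  obtain ⟨F, g, hF⟩ := Holonomy.exists_of_hom ρ
  have hm : F.along N.meridianLoop = 1 := by
    have h1 : ρ N.meridian = 1 := (QuotientGroup.eq_one_iff _).2
      (Subgroup.subset_normalClosure rfl)
    have h2 := (hF N.meridianLoop).symm.trans h1
    rwa [mul_inv_eq_one, mul_eq_left] at h2
  have hl := hF N.longitudeLoop
  rw [N.along_eq_one F hm, mul_one, mul_inv_cancel] at hl
  exact (QuotientGroup.eq_one_iff _).1 hl

end OrientedKnot.TubularNeighborhood

/-! ### Characters of the knot group and the conclusion. -/

namespace OrientedKnot.TubularNeighborhood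

variable {K : OrientedKnot}

/-- Characters of the knot group take arbitrary values on the meridian. -/
theorem exists_character (N : K.TubularNeighborhood) (c : ℂˣ) :
    ∃ χ : N.KnotGroup →* ℂˣ, χ N.meridian = c := by
  obtain ⟨χ, hχ⟩ := N.exists_linking_hom
  let e : Multiplicative ℂ →* ℂˣ :=
    { toFun := fun z => Units.mk0 (Complex.exp (Complex.log c / (2 * Real.pi * Complex.I) * z.toAdd))
        (Complex.exp_ne_zero _)
      map_one' := by ext; simp
      map_mul' := fun a b => by ext; simp [mul_add, Complex.exp_add] }
  refine ⟨e.comp χ, Units.ext ?_⟩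
  simp only [MonoidHom.comp_apply, hχ]
  change Complex.exp (Complex.log c / (2 * Real.pi * Complex.I) * (2 * Real.pi * Complex.I)) = c
  rw [div_mul_cancel₀ _ Complex.two_pi_I_ne_zero, Complex.exp_log c.ne_zero]

end OrientedKnot.TubularNeighborhood

theorem mainTheorem1 (K : OrientedKnot) (N : K.TubularNeighborhood) (hN : N.IsZeroFraming)
    (A Aaug : MvPolynomial (Fin 2) ℂ) (hA : N.IsAPolynomial A)
    (hcurve : N.AugmentationVarietyIsCurve) (hAaug : N.IsAugmentationPolynomial Aaug) :
    (1 - MvPolynomial.X 1 ^ 2) * A ∣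
      MvPolynomial.bind₁ ![MvPolynomial.X 0, -(MvPolynomial.X 1 ^ 2)] Aaug := by
  refine MvPolynomial.one_sub_X_sq_mul_dvd hA.cutsOut hA.squarefree hA.not_dvd hAaug hcurve ?_ ?_ ?_
  · intro x hx hx1
    obtain ⟨χ, hχ⟩ := N.exists_character (-Units.mk0 (x 1) (eigenvalueSet_ne_zero hx).2)
    -- The zero framing enters here: a character to a commutative group kills commutators.
    have hχl : χ N.longitude = 1 := Abelianization.commutator_subset_ker χ hN
    exact mem_augmentationSet_of_mem_eigenvalueSet N.meridian_mul_longitude hx hx1 χ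
      (by rw [hχ]; simp) hχl
  · intro x hx hx1
    exact sq_eq_one_of_mem_eigenvalueSet N.meridian_mul_longitude N.longitude_mem_normalClosure hx hx1
  · intro x h0 h1
    exact mem_augmentationSet_of_neg_one _ _ h0 h1
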